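/- All graphs are finite, simple and undirected. A \emph{tree decomposition} $t$ of a graph $G$ is a finite rooted forest (possibly with several trees, possibly empty if $G$ has no vertices) in which every node $x$ carries a bag $\beta(x)\subseteq V(G)$, such that both endpoints of every edge of $G$ lie in a common bag and, for every vertex $v$ of $G$, the nodes whose bags contain $v$ form a nonempty connected part of the forest. Its width is the maximum size of a bag minus one, and the treewidth of $G$ is the minimum width of a tree decomposition of $G$. The pathwidth of a graph is the minimum width of a path decomposition, i.e. a finite sequence of bags such that every vertex lies in some bag, both endpoints of every edge lie in a common bag, and the bags containing any given vertex are consecutive. (In both cases the width is taken to be $0$ when there is no nonempty bag.) The \emph{adhesion} $\sigma(x)$ of a node $x$ of $t$ is the intersection of $\beta(x)$ with the bag of the parent of $x$, and $\sigma(x)=\emptyset$ if $x$ is a root. The \emph{margin} of $x$ is $\mu(x)=\beta(x)\setminus\sigma(x)$. The \emph{marginal graph} of $x$ is the graph with vertex set $\mu(x)$ in which two distinct vertices are adjacent if they are adjacent in $G$ or both belong to the adhesion $\sigma(y)$ of some node $y$ of $t$. A \emph{guidance system} over $G$ is a family $\Lambda$ of in-trees in $G$, that is, of subgraphs of $G$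 that are trees, each with a chosen root towards which its edges are oriented. For a vertex $u$ let $\Lambda(u)$ be the set of roots of those trees of $\Lambda$ that contain $u$. The system $\Lambda$ \emph{captures} a family $\mathcal X$ of vertex sets if for every $X\in\mathcal X$ there is a vertex $u$ of $G$ with $X\subseteq\Lambda(u)$. It is \emph{colorable with $n$ colors} if its trees can be colored with $n$ colors so that any two distinct trees of the same color are vertex-disjoint. \textbf{Lemma.} Let $k\ge 0$ be an integer and let $G$ be a graph of treewidth at most $k$. Then $G$ admits a tree decomposition $t$ with the following properties: (a) the marginal graph of every node of $t$ has pathwidth at most $2k+1$; (b) the family of adhesions of all nodes of $t$ is captured by a guidance system over $G$ that is colorable with $4k^3+2k$ colors. -/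

import Mathlib

namespace GuidedDecomp

/-- A tree decomposition of a graph `G`: a finite rooted forest of nodes (given by its parent
function), each node carrying a bag of vertices, such that every edge of `G` has both endpoints in
some bag and, for every vertex, the nodes whose bags contain it form a nonempty connected part of
the forest. The forest may consist of several trees, and may be empty when `G` has no vertices. -/
structure TreeDecomposition {V : Type*} (G : SimpleGraph V) where
  /-- The nodes. -/
  Node : Type
  finite_node : Finite Node
  /-- The parent of a node; roots have none. -/
  parent : Node → Option Node
  /-- Iterating `parent` from any node ends in a root. -/
  wf : WellFounded (fun p c : Node => parent c = some p)
  /-- The bag of a node. -/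
  bag : Node → Set V
  edge_mem : ∀ u v : V, G.Adj u v → ∃ x, u ∈ bag x ∧ v ∈ bag x
  connected : ∀ v : V,
    ((SimpleGraph.fromRel (fun c p : Node => parent c = some p)).induce {x | v ∈ bag x}).Connected

namespace TreeDecomposition

variable {V : Type*} {G : SimpleGraph V}

/-- The width: maximum bag size minus one (and `0` if there are no nonempty bags). -/
noncomputable def width (t : TreeDecomposition G) : ℕ∞ :=
  ⨆ x, ((t.bag x).encard - 1)

/-- The adhesion of a node: the intersection of its bag with the bag of its parent; the adhesion of
a root is empty. -/
def adhesion (t : TreeDecomposition G) (x : t.Node) : Set V :=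
  {v | v ∈ t.bag x ∧ ∃ p, t.parent x = some p ∧ v ∈ t.bag p}

/-- The family of adhesions of all nodes. -/
def adhesions (t : TreeDecomposition G) : Set (Set V) :=
  Set.range t.adhesion

/-- The margin of a node: its bag minus its adhesion. -/
def margin (t : TreeDecomposition G) (x : t.Node) : Set V :=
  t.bag x \ t.adhesion x

/-- The graph obtained from `G` by turning every adhesion into a clique. -/
def adhesionClosure (t : TreeDecomposition G) : SimpleGraph V where
  Adj u v := G.Adj u v ∨ (u ≠ v ∧ ∃ y, u ∈ t.adhesion y ∧ v ∈ t.adhesion y)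
  symm := ⟨by
    rintro u v (h | ⟨h, y, hu, hv⟩)
    · exact Or.inl h.symm
    · exact Or.inr ⟨h.symm, y, hv, hu⟩⟩
  loopless := ⟨by
    rintro u (h | ⟨h, -⟩)
    · exact G.irrefl h
    · exact h rfl⟩

/-- The marginal graph of a node: the subgraph induced by its margin, with every two vertices of the
margin that lie together in an adhesion made adjacent. -/
def marginalGraph (t : TreeDecomposition G) (x : t.Node) : SimpleGraph (t.margin x) :=
  t.adhesionClosure.induce (t.margin x)

end TreeDecomposition

/-- The treewidth: the minimum width of a tree decomposition. -/
noncomputable def treewidth {V : Type*} (G : SimpleGraph V) : ℕ∞ :=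
  ⨅ t : TreeDecomposition G, t.width

/-- A path decomposition of a graph: a finite sequence of bags, such that every vertex is in some
bag, every edge has both endpoints in some bag, and the bags containing a given vertex are
consecutive. -/
structure PathDecomposition {V : Type*} (G : SimpleGraph V) where
  /-- The number of bags. -/
  length : ℕ
  /-- The bags, in order. -/
  bag : Fin length → Set V
  vertex_mem : ∀ v : V, ∃ i, v ∈ bag i
  edge_mem : ∀ u v : V, G.Adj u v → ∃ i, u ∈ bag i ∧ v ∈ bag i
  consecutive : ∀ (v : V) (i j l : Fin length), i ≤ j → j ≤ l → v ∈ bag i → v ∈ bag l → v ∈ bag j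

/-- The width: maximum bag size minus one (and `0` if there are no nonempty bags). -/
noncomputable def PathDecomposition.width {V : Type*} {G : SimpleGraph V}
    (p : PathDecomposition G) : ℕ∞ :=
  ⨆ i, ((p.bag i).encard - 1)

/-- The pathwidth: the minimum width of a path decomposition. -/
noncomputable def pathwidth {V : Type*} (G : SimpleGraph V) : ℕ∞ :=
  ⨅ p : PathDecomposition G, p.width

/-- An in-tree in `G`: a subgraph of `G` that is a tree, with a distinguished root. The orientation
of the edges towards the root is determined by these data. -/
structure InTree {V : Type*} (G : SimpleGraph V) where
  /-- The underlying subgraph. -/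
  tree : G.Subgraph
  isTree : tree.coe.IsTree
  /-- The root. -/
  root : V
  root_mem : root ∈ tree.verts

/-- A guidance system over `G`: a family of in-trees in `G`. -/
abbrev GuidanceSystem {V : Type*} (G : SimpleGraph V) := Set (InTree G)

namespace GuidanceSystem

variable {V : Type*} {G : SimpleGraph V}

/-- The vertices to which `u` is guided: the roots of the trees that contain `u`. -/
def targets (Λ : GuidanceSystem G) (u : V) : Set V :=
  {v | ∃ s ∈ Λ, u ∈ s.tree.verts ∧ s.root = v}

/-- A family of vertex sets is captured if each of its members is contained in the set of targets
of a single vertex. -/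
def Captures (Λ : GuidanceSystem G) (𝒳 : Set (Set V)) : Prop :=
  ∀ X ∈ 𝒳, ∃ u : V, X ⊆ Λ.targets u

/-- The trees can be colored with `n` colors so that distinct trees of the same color are
vertex-disjoint. -/
def Colorable (Λ : GuidanceSystem G) (n : ℕ) : Prop :=
  ∃ c : Λ → Fin n, ∀ s s' : Λ, s ≠ s' → c s = c s' →
    Disjoint s.1.tree.verts s'.1.tree.verts

end GuidanceSystem

end GuidedDecomp

/-! Order the vertices by the depth of their topmost node in a tree decomposition of width at most
`k`. The component `cone G v` of `v` among the vertices that are at least `v` then has a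
neighbourhood `front G v` of size at most `k` (`exists_linearOrder_front`). Two cones are nested or
disjoint, so they form a rooted forest on `V`; below, `u` is above `v` when `v ∈ cone G u`, and
`front G v` is a chain of vertices above `v`.

The new decomposition has one node for each member `z` of a set `R`: its margin is what remains of
`cone G z` after removing the smaller cones with root in `R`, and its adhesion is `front G z`. The
front is captured by its largest vertex `par z`, provided that every `x ∈ front G z` is joined to
`par z` through `cone G z`. The tree guiding to `v` is spanned by all these connections for `v`; it
lies in `cone G v`, so a greedy coloring in increasing order works if few trees of smaller vertices
meet the tree of `v`.

This congestion is controlled by a recursion (`exists_isGuide`). A cone `cone G r` receives at most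
`k²(2k-1)` demands, each asking for a connection between two vertices of `front G r`, and adds at
most `k` of its own. If this is too many, then by pigeonhole some pair `(p, q)` is demanded at least
`2k` times. If `p = q`, these demands are free. Otherwise the part of `r` consists of `r` and all
`x` whose cone cuts `p` from `q`. No cone hanging below this part cuts `p` from `q`, so a two-path
version of Menger's theorem (`exists_two_paths`) yields two routes with no such cone in common.
Splitting the `2k` demands between them spares every lower cone at least `k` demands
(`exists_step`).

The part has small pathwidth because its lowest members are cuts between `p` and `q` and hence are
linearly ordered from `p` to `q`. What lies between two consecutive ones is above one of the two, so
it consists of chains, on which two sets of size `k + 1` suffice as a bag (`hasLayout_two_chains`,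
`IsCutPrefix.hasLayout`). -/

namespace GuidedDecomp

open Set

universe u

/-! ### Connections inside a set of vertices -/

section Joined

variable {V : Type*} {G : SimpleGraph V}

/-- `a` and `b` are joined by a walk of `G` that stays inside `A`. -/
def JoinedIn (G : SimpleGraph V) (A : Set V) (a b : V) : Prop :=
  ∃ p : G.Walk a b, ∀ x ∈ p.support, x ∈ A

/-- Any two vertices of `A` are joined inside `A`. -/
def ConnSet (G : SimpleGraph V) (A : Set V) : Prop :=
  ∀ a ∈ A, ∀ b ∈ A, JoinedIn G A a b

namespace JoinedIn

variable {A B : Set V} {a b c : V}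

theorem refl (h : a ∈ A) : JoinedIn G A a a :=
  ⟨.nil, by simpa using h⟩

theorem symm (h : JoinedIn G A a b) : JoinedIn G A b a := by
  obtain ⟨p, hp⟩ := h
  exact ⟨p.reverse, by simpa using hp⟩

theorem trans (h : JoinedIn G A a b) (h' : JoinedIn G A b c) : JoinedIn G A a c := by
  obtain ⟨p, hp⟩ := h
  obtain ⟨q, hq⟩ := h'
  refine ⟨p.append q, fun x hx => ?_⟩
  rcases (SimpleGraph.Walk.mem_support_append_iff _ _).1 hx with h | h
  · exact hp x h
  · exact hq x h

theorem mono (hAB : A ⊆ B) (h : JoinedIn G A a b) : JoinedIn G B a b := by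
  obtain ⟨p, hp⟩ := h
  exact ⟨p, fun x hx => hAB (hp x hx)⟩

theorem left_mem (h : JoinedIn G A a b) : a ∈ A := by
  obtain ⟨p, hp⟩ := h
  exact hp _ p.start_mem_support

theorem right_mem (h : JoinedIn G A a b) : b ∈ A := h.symm.left_mem

theorem of_adj (h : G.Adj a b) (ha : a ∈ A) (hb : b ∈ A) : JoinedIn G A a b :=
  ⟨.cons h .nil, by simp [ha, hb]⟩

theorem induction {P : V → Prop} (h : JoinedIn G A a b) (h0 : P a)
    (hs : ∀ x y, JoinedIn G A a x → P x → G.Adj x y → y ∈ A → P y) : P b := by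
  obtain ⟨p, hp⟩ := h
  have key : ∀ (c : V) (q : G.Walk c b), JoinedIn G A a c → P c → (∀ x ∈ q.support, x ∈ A) →
      P b := by
    intro c q
    induction q with
    | nil => intro _ h _; exact h
    | cons hadj q ih =>
      rename_i u v w
      intro hj hPc hq
      have hv : v ∈ A := hq v (by simp)
      have hu : u ∈ A := hq u (by simp)
      exact ih p hp (hj.trans (of_adj hadj hu hv)) (hs _ _ hj hPc hadj hv)
        (fun x hx => hq x (by simp [hx]))
  exact key a p (refl (hp _ p.start_mem_support)) h0 hp

/-- The first vertex of `T` on a walk that cannot avoid `T`. -/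
theorem exists_first (T : Set V) (h : JoinedIn G A a b) (hn : ¬ JoinedIn G (A \ T) a b) :
    ∃ z ∈ T, z ∈ A ∧ (a = z ∨ ∃ y, JoinedIn G (A \ T) a y ∧ G.Adj y z) := by
  by_contra! hc
  refine hn (h.induction (P := fun x => JoinedIn G (A \ T) a x) ?_ ?_)
  · refine refl ⟨h.left_mem, fun haT => ?_⟩
    exact (hc a haT h.left_mem).1 rfl
  · intro x y _ hx hxy hy
    have hyT : y ∉ T := fun hyT => (hc y hyT hy).2 x hx hxy
    exact hx.trans (of_adj hxy hx.right_mem ⟨hy, hyT⟩)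

theorem connSet_component (x : V) : ConnSet G {u | JoinedIn G A x u} := by
  have key : ∀ u, JoinedIn G A x u → JoinedIn G {u | JoinedIn G A x u} x u := by
    intro u hu
    refine hu.induction (P := fun u => JoinedIn G {u | JoinedIn G A x u} x u) ?_ ?_
    · exact refl (refl hu.left_mem)
    · intro y z hy hPy hyz hz
      exact hPy.trans (of_adj hyz hy (hy.trans (of_adj hyz hy.right_mem hz)))
  intro a ha b hb
  exact (key a ha).symm.trans (key b hb)

end JoinedIn

theorem connSet_of_joined {A : Set V} (a : V) (h : ∀ x ∈ A, JoinedIn G A a x) : ConnSet G A :=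
  fun x hx y hy => (h x hx).symm.trans (h y hy)

end Joined

/-! ### The forest of cones of an ordered graph -/

section Elimination

variable {V : Type*} [LinearOrder V] {G : SimpleGraph V}

/-- The component of `v` in the subgraph induced by the vertices that are at least `v`. -/
def cone (G : SimpleGraph V) (v : V) : Set V := {u | JoinedIn G (Set.Ici v) v u}

/-- The neighbourhood of `cone G v`. -/
def front (G : SimpleGraph V) (v : V) : Set V := {u | u ∉ cone G v ∧ ∃ x ∈ cone G v, G.Adj x u}

variable {r u v w x y : V}

theorem self_mem_cone (v : V) : v ∈ cone G v := JoinedIn.refl (Set.mem_Ici.2 le_rfl)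

theorem le_of_mem_cone (h : u ∈ cone G v) : v ≤ u := h.right_mem

theorem connSet_cone (v : V) : ConnSet G (cone G v) := JoinedIn.connSet_component v

theorem mem_cone_of_adj (hx : x ∈ cone G v) (h : G.Adj x u) (hu : v ≤ u) : u ∈ cone G v :=
  JoinedIn.trans hx (JoinedIn.of_adj h (le_of_mem_cone hx) hu)

theorem cone_subset (h : u ∈ cone G v) : cone G u ⊆ cone G v := fun _ hx =>
  JoinedIn.trans h (JoinedIn.mono (Set.Ici_subset_Ici.2 (le_of_mem_cone h)) hx)

theorem front_lt (h : u ∈ front G v) : u < v := by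
  obtain ⟨hu, x, hx, hxu⟩ := h
  by_contra hc
  exact hu (mem_cone_of_adj hx hxu (not_lt.1 hc))

theorem mem_cone_of_mem_of_le (hu : x ∈ cone G u) (hv : x ∈ cone G v) (h : u ≤ v) :
    v ∈ cone G u :=
  JoinedIn.trans hu (JoinedIn.symm (JoinedIn.mono (Set.Ici_subset_Ici.2 h) hv))

theorem mem_front_of_adj (hx : x ∈ cone G v) (h : G.Adj x u) (hu : u < v) : u ∈ front G v :=
  ⟨fun hc => absurd (le_of_mem_cone hc) (not_le.2 hu), x, hx, h⟩

/-- The neighbour of `u` in `cone G v` also lies in `cone G u`, and overlapping cones are nested. So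
a front is a chain of vertices above `v`. -/
theorem mem_cone_of_mem_front (h : u ∈ front G v) : v ∈ cone G u := by
  obtain ⟨hu, x, hx, hxu⟩ := h
  have hlt : u < v := front_lt ⟨hu, x, hx, hxu⟩
  have hxc : x ∈ cone G u :=
    mem_cone_of_adj (self_mem_cone u) hxu.symm (hlt.le.trans (le_of_mem_cone hx))
  exact mem_cone_of_mem_of_le hxc hx hlt.le

theorem mem_cone_or_front (hw : w ∈ cone G v) (hu : u ∈ front G w) :
    u ∈ cone G v ∨ u ∈ front G v := by
  obtain ⟨-, x, hx, hxu⟩ := hu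
  by_cases h : u ∈ cone G v
  · exact Or.inl h
  · exact Or.inr ⟨h, x, cone_subset hw hx, hxu⟩

theorem mem_front_of_lt (hw : w ∈ cone G v) (hu : u ∈ front G w) (h : u < v) : u ∈ front G v :=
  (mem_cone_or_front hw hu).resolve_left fun hc => absurd (le_of_mem_cone hc) (not_le.2 h)

theorem mem_front_of_mem_front (hu : u ∈ front G w) (hv : v ∈ front G w) (h : u < v) :
    u ∈ front G v :=
  mem_front_of_lt (mem_cone_of_mem_front hv) hu h

theorem eq_of_mem_cone_of_mem_cone (h : u ∈ cone G v) (h' : v ∈ cone G u) : u = v :=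
  le_antisymm (le_of_mem_cone h') (le_of_mem_cone h)

theorem mem_cone_trans (h : u ∈ cone G v) (h' : v ∈ cone G w) : u ∈ cone G w :=
  cone_subset h' h

theorem mem_cone_or_mem_cone (hu : x ∈ cone G u) (hv : x ∈ cone G v) :
    v ∈ cone G u ∨ u ∈ cone G v := by
  rcases le_total u v with h | h
  · exact Or.inl (mem_cone_of_mem_of_le hu hv h)
  · exact Or.inr (mem_cone_of_mem_of_le hv hu h)

end Elimination

/-! ### Menger's theorem for two paths disjoint on `W` -/

section TwoPaths

variable {V : Type*} {H : SimpleGraph V} {W : Set V} {p q : V}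

/-- `r` is reached from `p` by two connected sets that share no vertex of `W` except possibly
`r`. -/
def TwiceReached (H : SimpleGraph V) (W : Set V) (p r : V) : Prop :=
  ∃ A B : Set V, JoinedIn H A p r ∧ JoinedIn H B p r ∧ ∀ w ∈ W, w ∈ A → w ∈ B → w = r

/-- Vertices outside `W` may be shared, so both sets can be prolonged through `r`. Hence the twice
reached vertices can only be left at a vertex of `W`. -/
theorem TwiceReached.of_adj {r s : V} (h : TwiceReached H W p r) (hr : r ∉ W) (hrs : H.Adj r s) :
    TwiceReached H W p s := by
  obtain ⟨A, B, hA, hB, hAB⟩ := h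
  refine ⟨insert s A, insert s B,
    (hA.mono (subset_insert _ _)).trans
      (JoinedIn.of_adj hrs (mem_insert_of_mem _ hA.right_mem) (mem_insert _ _)),
    (hB.mono (subset_insert _ _)).trans
      (JoinedIn.of_adj hrs (mem_insert_of_mem _ hB.right_mem) (mem_insert _ _)), ?_⟩
  intro w hw h1 h2
  rcases h1 with h1 | h1
  · exact h1
  rcases h2 with h2 | h2
  · exact h2
  exact absurd (hAB w hw h1 h2 ▸ hw) hr

/-- The part of a connected set reaching `r` that is seen before `r`. -/
theorem JoinedIn.exists_adj_avoiding {A : Set V} {r : V} (h : JoinedIn H A p r) (hpr : p ≠ r) :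
    ∃ a, JoinedIn H (A \ {r}) p a ∧ H.Adj a r := by
  obtain ⟨z, hz, -, h1⟩ := h.exists_first {r} (fun hc => hc.right_mem.2 rfl)
  obtain rfl : z = r := hz
  exact h1.resolve_left hpr

/-- One of the two sets reaching `r₂` misses `r₁`. Followed back from `r₂`, it first meets one of
the two connections from `p` to `r₁`; continuing along that one to `p` leaves the other free to
reach `r₁`. -/
theorem twiceReached_merge {r₁ r₂ : V} (hp : p ∉ W) (hr₁ : r₁ ∈ W)
    (hne : r₁ ≠ r₂) (h₁ : TwiceReached H W p r₁) (h₂ : TwiceReached H W p r₂) :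
    ∃ P₁ P₂ : Set V, JoinedIn H P₁ p r₂ ∧ JoinedIn H P₂ p r₁ ∧ ∀ w ∈ W, w ∈ P₁ → w ∉ P₂ := by
  have hpr₁ : p ≠ r₁ := fun h => hp (h ▸ hr₁)
  obtain ⟨A₁, B₁, hA₁, hB₁, hAB₁⟩ := h₁
  obtain ⟨A, hA, hrA⟩ : ∃ A, JoinedIn H A p r₂ ∧ r₁ ∉ A := by
    obtain ⟨A₂, B₂, hA₂, hB₂, hAB₂⟩ := h₂
    by_cases h : r₁ ∈ A₂
    · exact ⟨B₂, hB₂, fun h' => hne (hAB₂ r₁ hr₁ h h')⟩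
    · exact ⟨A₂, hA₂, h⟩
  have key : ∀ A₁ B₁ : Set V, JoinedIn H A₁ p r₁ → JoinedIn H B₁ p r₁ →
      (∀ w ∈ W, w ∈ A₁ → w ∈ B₁ → w = r₁) →
      ∀ T, T = {x | JoinedIn H (A₁ \ {r₁}) p x} ∪ {x | JoinedIn H (B₁ \ {r₁}) p x} →
      ∀ z, JoinedIn H (A₁ \ {r₁}) p z → (r₂ = z ∨ ∃ y, JoinedIn H (A \ T) r₂ y ∧ H.Adj y z) →
      ∃ P₁ P₂ : Set V, JoinedIn H P₁ p r₂ ∧ JoinedIn H P₂ p r₁ ∧ ∀ w ∈ W, w ∈ P₁ → w ∉ P₂ := by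
    intro A₁ B₁ hA₁ hB₁ hAB₁ T hT z hz hzr
    obtain ⟨b, hb, hbr⟩ := hB₁.exists_adj_avoiding hpr₁
    have hpA : ConnSet H {x | JoinedIn H (A₁ \ {r₁}) p x} := JoinedIn.connSet_component p
    have hpB : ConnSet H {x | JoinedIn H (B₁ \ {r₁}) p x} := JoinedIn.connSet_component p
    have hpA' : JoinedIn H (A₁ \ {r₁}) p p := JoinedIn.refl hz.left_mem
    have hpB' : JoinedIn H (B₁ \ {r₁}) p p := JoinedIn.refl hb.left_mem
    refine ⟨{x | JoinedIn H (A₁ \ {r₁}) p x} ∪ {x | JoinedIn H (A \ T) r₂ x},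
      insert r₁ {x | JoinedIn H (B₁ \ {r₁}) p x}, ?_, ?_, ?_⟩
    · have h1 := JoinedIn.mono (B := {x | JoinedIn H (A₁ \ {r₁}) p x} ∪
        {x | JoinedIn H (A \ T) r₂ x}) subset_union_left (hpA p hpA' z hz)
      rcases hzr with rfl | ⟨y, hy, hyz⟩
      · exact h1
      · have hr₂ : JoinedIn H (A \ T) r₂ r₂ := JoinedIn.refl hy.left_mem
        refine h1.trans ((JoinedIn.of_adj hyz.symm (Or.inl hz) (Or.inr hy)).trans ?_)
        exact ((JoinedIn.connSet_component r₂) y hy r₂ hr₂).mono subset_union_right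
    · exact ((hpB p hpB' b hb).mono (subset_insert _ _)).trans
        (JoinedIn.of_adj hbr (mem_insert_of_mem _ hb) (mem_insert _ _))
    · rintro w hw (h1 | h1) (rfl | h2)
      · exact h1.right_mem.2 rfl
      · exact h1.right_mem.2 (hAB₁ w hw h1.right_mem.1 h2.right_mem.1)
      · exact hrA h1.right_mem.1
      · exact h1.right_mem.2 (hT ▸ Or.inr h2)
  obtain ⟨a, ha, -⟩ := hA₁.exists_adj_avoiding hpr₁
  obtain ⟨z, hzT, -, hzr⟩ := hA.symm.exists_first
    ({x | JoinedIn H (A₁ \ {r₁}) p x} ∪ {x | JoinedIn H (B₁ \ {r₁}) p x})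
    (fun hc => hc.right_mem.2 (Or.inl (JoinedIn.refl ha.left_mem)))
  rcases hzT with hz | hz
  · exact key A₁ B₁ hA₁ hB₁ hAB₁ _ rfl z hz hzr
  · exact key B₁ A₁ hB₁ hA₁ (fun w hw h h' => hAB₁ w hw h' h) _ (union_comm _ _) z hz hzr

/-- If `q` is not reached twice, every connection from `p` to `q` crosses from the twice reached set
`X` to the component `Y` of `q` outside `X`, at a vertex of `W`. No such vertex separates, so there
are two crossings. The merged connections to them, joined through `Y`, reach a vertex of `Y` twice.
-/
theorem twiceReached_of_not_separating (hp : p ∉ W)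
    (h0 : JoinedIn H univ p q) (h : ∀ w ∈ W, JoinedIn H {w}ᶜ p q) : TwiceReached H W p q := by
  by_contra hq
  set X : Set V := {r | TwiceReached H W p r} with hX
  have hpX : p ∈ X := ⟨{p}, {p}, JoinedIn.refl rfl, JoinedIn.refl rfl, fun w _ h _ => h⟩
  set Y : Set V := {x | JoinedIn H Xᶜ q x} with hY
  have hqY : q ∈ Y := JoinedIn.refl hq
  have hYX : ∀ y ∈ Y, y ∉ X := fun y hy => JoinedIn.right_mem hy
  have hstep : ∀ D : Set V, JoinedIn H D p q → ∃ r ∈ X ∩ W ∩ D, ∃ y ∈ Y, H.Adj r y := by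
    intro D hD
    obtain ⟨z, hz, -, hzr⟩ := hD.exists_first Y (fun hc => hc.right_mem.2 hqY)
    rcases hzr with rfl | ⟨y, hy, hyz⟩
    · exact absurd hpX (hYX _ hz)
    · have hyX : y ∈ X := by
        by_contra hyX
        exact hy.right_mem.2 (JoinedIn.trans hz (JoinedIn.of_adj hyz.symm (hYX z hz) hyX))
      refine ⟨y, ⟨⟨hyX, ?_⟩, hy.right_mem.1⟩, z, hz, hyz⟩
      by_contra hyW
      exact hYX z hz (TwiceReached.of_adj hyX hyW hyz)
  obtain ⟨r₁, ⟨⟨hr₁X, hr₁W⟩, -⟩, y₁, hy₁, hry₁⟩ := hstep _ h0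
  obtain ⟨r₂, ⟨⟨hr₂X, hr₂W⟩, hr₂⟩, y₂, hy₂, hry₂⟩ := hstep _ (h r₁ hr₁W)
  obtain ⟨P₁, P₂, hP₁, hP₂, hP⟩ :=
    twiceReached_merge hp hr₁W (fun h => hr₂ h.symm) hr₁X hr₂X
  -- Each connection is cut at its first vertex in `Y`, so that afterwards only one of the two runs
  -- through `Y`.
  have htrunc : ∀ (P : Set V) (r y : V), JoinedIn H P p r → y ∈ Y → H.Adj r y →
      ∃ a, JoinedIn H (P \ Y) p a ∧ ∃ z ∈ Y, H.Adj a z := by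
    intro P r y hPr hy hry
    have hj : JoinedIn H (P ∪ Y) p y := (hPr.mono subset_union_left).trans
      (JoinedIn.of_adj hry (Or.inl hPr.right_mem) (Or.inr hy))
    obtain ⟨z, hz, -, hzr⟩ := hj.exists_first Y (fun hc => hc.right_mem.2 hy)
    rcases hzr with rfl | ⟨a, ha, haz⟩
    · exact absurd hpX (hYX _ hz)
    · exact ⟨a, ha.mono (by intro x hx; exact ⟨hx.1.resolve_right hx.2, hx.2⟩), z, hz, haz⟩
  obtain ⟨a₁, ha₁, z₁, hz₁, haz₁⟩ := htrunc P₁ r₂ y₂ hP₁ hy₂ hry₂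
  obtain ⟨a₂, ha₂, z₂, hz₂, haz₂⟩ := htrunc P₂ r₁ y₁ hP₂ hy₁ hry₁
  refine hYX z₂ hz₂ ⟨(P₁ \ Y) ∪ Y, insert z₂ (P₂ \ Y), ?_, ?_, ?_⟩
  · refine (ha₁.mono subset_union_left).trans
      ((JoinedIn.of_adj haz₁ (Or.inl ha₁.right_mem) (Or.inr hz₁)).trans ?_)
    exact ((JoinedIn.connSet_component q) z₁ hz₁ z₂ hz₂).mono subset_union_right
  · exact (ha₂.mono (subset_insert _ _)).trans
      (JoinedIn.of_adj haz₂ (mem_insert_of_mem _ ha₂.right_mem) (mem_insert _ _))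
  · rintro w hw (h1 | h1) (rfl | h2)
    · rfl
    · exact absurd h2.1 (hP w hw h1.1)
    · rfl
    · exact absurd h1 h2.2

/-- Two paths that share no vertex of `W`, if no vertex of `W` separates their ends. -/
theorem exists_two_paths (hp : p ∉ W) (hq : q ∉ W)
    (h0 : JoinedIn H univ p q) (h : ∀ w ∈ W, JoinedIn H {w}ᶜ p q) :
    ∃ A B : H.Walk p q, A.IsPath ∧ B.IsPath ∧ ∀ w ∈ W, w ∈ A.support → w ∉ B.support := by
  classical
  obtain ⟨A, B, ⟨a, ha⟩, ⟨b, hb⟩, hAB⟩ := twiceReached_of_not_separating hp h0 h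
  refine ⟨a.bypass, b.bypass, a.bypass_isPath, b.bypass_isPath, fun w hw h1 h2 => hq ?_⟩
  rw [← hAB w hw (ha w (a.support_bypass_subset_support h1))
    (hb w (b.support_bypass_subset_support h2))]
  exact hw

end TwoPaths

/-! ### Lifting paths of a contracted graph -/

section Substitution

variable {V : Type*} {G H : SimpleGraph V} {W : Set V} {F : V → Set V}

theorem ConnSet.joinedIn_of_subset {A B : Set V} {a b : V} (h : ConnSet G A) (hAB : A ⊆ B)
    (ha : a ∈ A) (hb : b ∈ A) : JoinedIn G B a b := (h a ha b hb).mono hAB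

/-- Replacing the vertices of `W` on a path of a contracted graph by connected sets. -/
theorem exists_substitution
    (h1 : ∀ x y, x ∉ W → y ∉ W → H.Adj x y → G.Adj x y)
    (h2 : ∀ w y, w ∈ W → y ∉ W → H.Adj w y → y ∈ F w)
    (h3 : ∀ w w', w ∈ W → w' ∈ W → ¬ H.Adj w w')
    {b : V} (hb : b ∉ W) :
    ∀ {a : V} (p : H.Walk a b), p.IsPath → a ∉ W → ∃ f g : V → V,
      (∀ w ∈ p.support, w ∈ W → f w ∈ F w ∧ g w ∈ F w ∧
        (f w ∈ p.support ∧ f w ∉ W) ∧ (g w ∈ p.support ∧ g w ∉ W)) ∧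
      ∀ K : V → Set V, (∀ w ∈ p.support, w ∈ W → ConnSet G (K w) ∧ f w ∈ K w ∧ g w ∈ K w) →
        ∀ x ∈ {x | x ∈ p.support ∧ x ∉ W} ∪ ⋃ w ∈ {w | w ∈ p.support ∧ w ∈ W}, K w,
          JoinedIn G ({x | x ∈ p.support ∧ x ∉ W} ∪ ⋃ w ∈ {w | w ∈ p.support ∧ w ∈ W}, K w) a x
  | a, .nil, _, ha => by
    refine ⟨id, id, ?_, ?_⟩
    · intro w hw hwW
      simp only [SimpleGraph.Walk.support_nil, List.mem_singleton] at hw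
      exact absurd (hw ▸ hwW) ha
    · rintro K - x (hx | hx)
      · have hxa : x = a := by simpa using hx.1
        subst hxa
        exact JoinedIn.refl (Or.inl hx)
      · simp only [mem_iUnion, mem_ofPred_eq, SimpleGraph.Walk.support_nil,
          List.mem_singleton] at hx
        obtain ⟨w, ⟨rfl, hw⟩, -⟩ := hx
        exact absurd hw ha
  | a, .cons (v := v) hav p, hp, ha => by
    classical
    by_cases hv : v ∈ W
    · match p, hp with
      | .nil, _ => exact absurd hv hb
      | .cons (v := u) hvu p', hp =>
        have hu : u ∉ W := fun hu => h3 v u hv hu hvu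
        rw [SimpleGraph.Walk.cons_isPath_iff, SimpleGraph.Walk.cons_isPath_iff] at hp
        obtain ⟨⟨hp', hvp⟩, hap⟩ := hp
        obtain ⟨f, g, hfg, hK⟩ := exists_substitution h1 h2 h3 hb p' hp' hu
        have hne : ∀ w ∈ p'.support, w ≠ v := fun w hw h => hvp (h ▸ hw)
        -- The path enters `v` from `a` and leaves it for `u`. Both are outside `W`: `W` is
        -- independent, and the path does not end in it.
        refine ⟨Function.update f v a, Function.update g v u, ?_, ?_⟩
        · intro w hw hwW
          by_cases hwv : w = v
          · subst hwv
            simp only [Function.update_self]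
            exact ⟨h2 _ _ hwW ha hav.symm, h2 _ _ hwW hu hvu, ⟨by simp, ha⟩, ⟨by simp, hu⟩⟩
          · simp only [Function.update_of_ne hwv]
            have hw' : w ∈ p'.support := by
              simp only [SimpleGraph.Walk.support_cons, List.mem_cons] at hw
              rcases hw with rfl | rfl | hw
              · exact absurd hwW ha
              · exact absurd rfl hwv
              · exact hw
            obtain ⟨e1, e2, e3, e4⟩ := hfg w hw' hwW
            exact ⟨e1, e2, ⟨by simp [e3.1], e3.2⟩, ⟨by simp [e4.1], e4.2⟩⟩
        · intro K hKc
          have hK' := hK K (fun w hw hwW => by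
            have := hKc w (by simp [hw]) hwW
            simpa [Function.update_of_ne (hne w hw)] using this)
          obtain ⟨hKv, hfv, hgv⟩ := hKc v (by simp) hv
          simp only [Function.update_self] at hfv hgv
          set T' := {x | x ∈ p'.support ∧ x ∉ W} ∪ ⋃ w ∈ {w | w ∈ p'.support ∧ w ∈ W}, K w
          set T := {x | x ∈ (SimpleGraph.Walk.cons hav (.cons hvu p')).support ∧ x ∉ W} ∪
            ⋃ w ∈ {w | w ∈ (SimpleGraph.Walk.cons hav (.cons hvu p')).support ∧ w ∈ W}, K w
            with hT
          have hT'T : T' ⊆ T := by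
            rintro x (hx | hx)
            · exact Or.inl ⟨by simp [hx.1], hx.2⟩
            · simp only [mem_iUnion, mem_ofPred_eq] at hx
              obtain ⟨w, ⟨hw, hwW⟩, hx⟩ := hx
              exact Or.inr (mem_biUnion (x := w) ⟨by simp [hw], hwW⟩ hx)
          have hKT : K v ⊆ T := fun x hx => Or.inr (mem_biUnion (x := v) ⟨by simp, hv⟩ hx)
          have haT : a ∈ T := hKT hfv
          have hau : JoinedIn G T a u := hKv.joinedIn_of_subset hKT hfv hgv
          intro x hx
          rcases hx with hx | hx
          · have hx1 := hx.1
            simp only [SimpleGraph.Walk.support_cons, List.mem_cons] at hx1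
            rcases hx1 with rfl | rfl | hx1
            · exact JoinedIn.refl haT
            · exact absurd hv hx.2
            · exact hau.trans ((hK' x (Or.inl ⟨hx1, hx.2⟩)).mono hT'T)
          · simp only [mem_iUnion, mem_ofPred_eq] at hx
            obtain ⟨w, ⟨hw, hwW⟩, hx⟩ := hx
            simp only [SimpleGraph.Walk.support_cons, List.mem_cons] at hw
            rcases hw with rfl | rfl | hw
            · exact absurd hwW ha
            · exact hKv.joinedIn_of_subset hKT hfv hx
            · exact hau.trans ((hK' x (Or.inr (mem_biUnion (x := w) ⟨hw, hwW⟩ hx))).mono hT'T)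
    · rw [SimpleGraph.Walk.cons_isPath_iff] at hp
      obtain ⟨hp', hap⟩ := hp
      obtain ⟨f, g, hfg, hK⟩ := exists_substitution h1 h2 h3 hb p hp' hv
      refine ⟨f, g, ?_, ?_⟩
      · intro w hw hwW
        have hw' : w ∈ p.support := by
          simp only [SimpleGraph.Walk.support_cons, List.mem_cons] at hw
          rcases hw with rfl | hw
          · exact absurd hwW ha
          · exact hw
        obtain ⟨e1, e2, e3, e4⟩ := hfg w hw' hwW
        exact ⟨e1, e2, ⟨by simp [e3.1], e3.2⟩, ⟨by simp [e4.1], e4.2⟩⟩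
      · intro K hKc
        have hK' := hK K (fun w hw hwW => hKc w (by simp [hw]) hwW)
        set T' := {x | x ∈ p.support ∧ x ∉ W} ∪ ⋃ w ∈ {w | w ∈ p.support ∧ w ∈ W}, K w
        set T := {x | x ∈ (SimpleGraph.Walk.cons hav p).support ∧ x ∉ W} ∪
          ⋃ w ∈ {w | w ∈ (SimpleGraph.Walk.cons hav p).support ∧ w ∈ W}, K w
        have hT'T : T' ⊆ T := by
          rintro x (hx | hx)
          · exact Or.inl ⟨by simp [hx.1], hx.2⟩
          · simp only [mem_iUnion, mem_ofPred_eq] at hx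
            obtain ⟨w, ⟨hw, hwW⟩, hx⟩ := hx
            exact Or.inr (mem_biUnion (x := w) ⟨by simp [hw], hwW⟩ hx)
        have haT : a ∈ T := Or.inl ⟨by simp, ha⟩
        have hvT : v ∈ T := Or.inl ⟨by simp, hv⟩
        have hav' : JoinedIn G T a v := JoinedIn.of_adj (h1 a v ha hv hav) haT hvT
        intro x hx
        rcases hx with hx | hx
        · have hx1 := hx.1
          simp only [SimpleGraph.Walk.support_cons, List.mem_cons] at hx1
          rcases hx1 with rfl | hx1
          · exact JoinedIn.refl haT
          · exact hav'.trans ((hK' x (Or.inl ⟨hx1, hx.2⟩)).mono hT'T)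
        · simp only [mem_iUnion, mem_ofPred_eq] at hx
          obtain ⟨w, ⟨hw, hwW⟩, hx⟩ := hx
          simp only [SimpleGraph.Walk.support_cons, List.mem_cons] at hw
          rcases hw with rfl | hw
          · exact absurd hwW ha
          · exact hav'.trans ((hK' x (Or.inr (mem_biUnion (x := w) ⟨hw, hwW⟩ hx))).mono hT'T)
  termination_by a p => p.length

end Substitution

/-! ### Path decompositions with prescribed end bags -/

section Layout

variable {V : Type u} {n : ℕ∞} {adj : V → V → Prop} {A A₁ A₂ X X' Y Y' X₂ Y₁ : Set V}

/-- A path decomposition of the relation `adj` on `A` with bags of size at most `n`, indexed by a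
finite linear order, whose first bag contains `X` and whose last bag contains `Y`. -/
def HasLayout (n : ℕ∞) (adj : V → V → Prop) (A X Y : Set V) : Prop :=
  ∃ (ι : Type u) (_ : LinearOrder ι) (_ : Finite ι) (bag : ι → Set V),
    (∀ i, bag i ⊆ A) ∧ (∀ i, (bag i).encard ≤ n) ∧ (∀ v ∈ A, ∃ i, v ∈ bag i) ∧
    (∀ u ∈ A, ∀ v ∈ A, adj u v → ∃ i, u ∈ bag i ∧ v ∈ bag i) ∧
    (∀ v i j l, i ≤ j → j ≤ l → v ∈ bag i → v ∈ bag l → v ∈ bag j) ∧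
    (∃ i, (∀ j, i ≤ j) ∧ X ⊆ bag i) ∧ (∃ i, (∀ j, j ≤ i) ∧ Y ⊆ bag i)

theorem HasLayout.mono (h : HasLayout n adj A X Y) (hX : X' ⊆ X) (hY : Y' ⊆ Y) :
    HasLayout n adj A X' Y' := by
  obtain ⟨ι, i1, i2, bag, h1, h2, h3, h4, h5, ⟨i, hi, hi'⟩, ⟨j, hj, hj'⟩⟩ := h
  exact ⟨ι, i1, i2, bag, h1, h2, h3, h4, h5, ⟨i, hi, hX.trans hi'⟩, ⟨j, hj, hY.trans hj'⟩⟩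

theorem HasLayout.reverse (h : HasLayout n adj A X Y) : HasLayout n adj A Y X := by
  obtain ⟨ι, i1, i2, bag, h1, h2, h3, h4, h5, ⟨i, hi, hi'⟩, ⟨j, hj, hj'⟩⟩ := h
  exact ⟨ιᵒᵈ, inferInstance, inferInstanceAs (Finite ι), fun i => bag (OrderDual.ofDual i),
    fun i => h1 _, fun i => h2 _, h3, h4,
    fun v a b c hab hbc ha hc => h5 v (OrderDual.ofDual c) (OrderDual.ofDual b)
      (OrderDual.ofDual a) hbc hab hc ha,
    ⟨OrderDual.toDual j, fun l => hj (OrderDual.ofDual l), hj'⟩,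
    ⟨OrderDual.toDual i, fun l => hi (OrderDual.ofDual l), hi'⟩⟩

theorem HasLayout.single (hA : A.encard ≤ n) : HasLayout n adj A A A :=
  ⟨PUnit, inferInstance, inferInstance, fun _ => A, fun _ => subset_rfl, fun _ => hA,
    fun _ hv => ⟨⟨⟩, hv⟩, fun _ hu _ hv _ => ⟨⟨⟩, hu, hv⟩, fun _ _ _ _ _ _ h _ => h,
    ⟨⟨⟩, fun _ => le_rfl, subset_rfl⟩, ⟨⟨⟩, fun _ => le_rfl, subset_rfl⟩⟩

/-- A shared vertex occurs in the last bag of the first sequence and in the first bag of the second,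
so its two intervals join; `hc` excludes edges that neither side sees. -/
theorem HasLayout.append (hadj : ∀ u v, adj u v → adj v u)
    (h : HasLayout n adj A₁ X Y₁) (h' : HasLayout n adj A₂ X₂ Y)
    (hY : A₁ ∩ A₂ ⊆ Y₁) (hX : A₁ ∩ A₂ ⊆ X₂)
    (hc : ∀ u ∈ A₁, ∀ v ∈ A₂, adj u v → u ∈ A₂ ∨ v ∈ A₁) :
    HasLayout n adj (A₁ ∪ A₂) X Y := by
  obtain ⟨ι, i1, i2, b, h1, h2, h3, h4, h5, ⟨s, hs, hs'⟩, ⟨t, ht, ht'⟩⟩ := h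
  obtain ⟨κ, k1, k2, c, g1, g2, g3, g4, g5, ⟨s₂, hs₂, hs₂'⟩, ⟨t₂, ht₂, ht₂'⟩⟩ := h'
  refine ⟨Lex (ι ⊕ κ), inferInstance, inferInstanceAs (Finite (ι ⊕ κ)),
    fun i => Sum.elim b c (ofLex i), ?_, ?_, ?_, ?_, ?_, ?_, ?_⟩
  · intro i
    obtain ⟨i, rfl⟩ := toLex.surjective i
    rcases i with i | i
    · exact (h1 i).trans subset_union_left
    · exact (g1 i).trans subset_union_right
  · intro i
    obtain ⟨i, rfl⟩ := toLex.surjective i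
    rcases i with i | i
    · exact h2 i
    · exact g2 i
  · rintro v (hv | hv)
    · obtain ⟨i, hi⟩ := h3 v hv
      exact ⟨toLex (Sum.inl i), hi⟩
    · obtain ⟨i, hi⟩ := g3 v hv
      exact ⟨toLex (Sum.inr i), hi⟩
  · have left : ∀ u ∈ A₁, ∀ v ∈ A₁, adj u v →
        ∃ i : Lex (ι ⊕ κ), u ∈ Sum.elim b c (ofLex i) ∧ v ∈ Sum.elim b c (ofLex i) := by
      intro u hu v hv huv
      obtain ⟨i, hi⟩ := h4 u hu v hv huv
      exact ⟨toLex (Sum.inl i), hi⟩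
    have right : ∀ u ∈ A₂, ∀ v ∈ A₂, adj u v →
        ∃ i : Lex (ι ⊕ κ), u ∈ Sum.elim b c (ofLex i) ∧ v ∈ Sum.elim b c (ofLex i) := by
      intro u hu v hv huv
      obtain ⟨i, hi⟩ := g4 u hu v hv huv
      exact ⟨toLex (Sum.inr i), hi⟩
    rintro u (hu | hu) v (hv | hv) huv
    · exact left u hu v hv huv
    · rcases hc u hu v hv huv with h | h
      · exact right u h v hv huv
      · exact left u hu v h huv
    · rcases hc v hv u hu (hadj _ _ huv) with h | h
      · exact right u hu v h huv
      · exact left u h v hv huv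
    · exact right u hu v hv huv
  · intro v i j l hij hjl hi hl
    obtain ⟨i, rfl⟩ := toLex.surjective i
    obtain ⟨j, rfl⟩ := toLex.surjective j
    obtain ⟨l, rfl⟩ := toLex.surjective l
    rcases i with i | i <;> rcases j with j | j <;> rcases l with l | l <;>
      simp only [Sum.Lex.inl_le_inl_iff, Sum.Lex.inr_le_inr_iff, Sum.Lex.not_inr_le_inl,
        ofLex_toLex, Sum.elim_inl, Sum.elim_inr] at hij hjl hi hl ⊢
    · exact h5 v i j l hij hjl hi hl
    · exact h5 v i j t hij (ht j) hi (ht' (hY ⟨h1 i hi, g1 l hl⟩))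
    · exact g5 v s₂ j l (hs₂ j) hjl (hs₂' (hX ⟨h1 i hi, g1 l hl⟩)) hl
    · exact g5 v i j l hij hjl hi hl
  · refine ⟨toLex (Sum.inl s), fun j => ?_, hs'⟩
    obtain ⟨j, rfl⟩ := toLex.surjective j
    rcases j with j | j
    · exact Sum.Lex.inl_le_inl_iff.2 (hs j)
    · exact Sum.Lex.inl_le_inr _ _
  · refine ⟨toLex (Sum.inr t₂), fun j => ?_, ht₂'⟩
    obtain ⟨j, rfl⟩ := toLex.surjective j
    rcases j with j | j
    · exact Sum.Lex.inl_le_inr _ _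
    · exact Sum.Lex.inr_le_inr_iff.2 (ht₂ j)

end Layout

/-! ### Layouts of chains of the forest -/

section Chains

variable {V : Type u} [LinearOrder V] {G : SimpleGraph V} {k : ℕ}
  {adj : V → V → Prop} {B : Set V} {r x y lo hi c : V}

/-- The bag of `v` in the decomposition of width `k` given by the order. -/
def bagAt (G : SimpleGraph V) (v : V) : Set V := insert v (front G v)

theorem encard_bagAt_le (hk : ∀ v, (front G v).encard ≤ k) (v : V) :
    (bagAt G v).encard ≤ k + 1 :=
  (encard_insert_le _ _).trans (by gcongr; exact hk v)

theorem encard_bagAt_union_le (hk : ∀ v, (front G v).encard ≤ k) (v w : V) :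
    (bagAt G v ∪ bagAt G w).encard ≤ ((2 * k + 2 : ℕ) : ℕ∞) := by
  refine (encard_union_le _ _).trans ((add_le_add (encard_bagAt_le hk v)
    (encard_bagAt_le hk w)).trans (le_of_eq ?_))
  push_cast
  ring

/-- The vertices between `lo` and `hi`. -/
def chain (G : SimpleGraph V) (lo hi : V) : Set V := {v | v ∈ cone G lo ∧ hi ∈ cone G v}

/-- The chain indexes its own bags: `i` gets `bagAt G i` together with the constant set `bagAt G c`.
Bags are consecutive because a vertex of `front G l` that precedes some `j` above `l` also belongs
to `front G j`. The hypotheses `h1` and `h2` keep the bags inside the set and exclude unseen edges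
from the chain to `bagAt G c`. -/
theorem hasLayout_chain [Finite V] (hk : ∀ v, (front G v).encard ≤ k)
    (hsymm : ∀ u v, adj u v → adj v u)
    (hadj : ∀ u v, adj u v → u < v → u ∈ front G v) (hhi : hi ∈ cone G lo)
    (h1 : ∀ v ∈ chain G lo hi, ∀ u ∈ front G v, u ∈ B → u ∈ chain G lo hi ∨ u ∈ bagAt G c)
    (h2 : ∀ u ∈ chain G lo hi, ∀ v ∈ bagAt G c, v ∈ B → u ∈ front G v →
      v ∈ chain G lo hi ∨ u ∈ bagAt G c) :
    HasLayout (2 * k + 2 : ℕ) adj ((chain G lo hi ∪ bagAt G c) ∩ B) (bagAt G c ∩ B)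
      ((bagAt G hi ∪ bagAt G c) ∩ B) := by
  have hlo : lo ∈ chain G lo hi := ⟨self_mem_cone _, hhi⟩
  have hhi' : hi ∈ chain G lo hi := ⟨hhi, self_mem_cone _⟩
  have hlt : ∀ u ∈ (chain G lo hi ∪ bagAt G c) ∩ B, ∀ v ∈ (chain G lo hi ∪ bagAt G c) ∩ B,
      u < v → u ∈ front G v → ∃ i : chain G lo hi,
        u ∈ (bagAt G i ∪ bagAt G c) ∩ B ∧ v ∈ (bagAt G i ∪ bagAt G c) ∩ B := by
    intro u hu v hv huv huf
    by_cases hvc : v ∈ chain G lo hi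
    · exact ⟨⟨v, hvc⟩, ⟨Or.inl (Or.inr huf), hu.2⟩, ⟨Or.inl (Or.inl rfl), hv.2⟩⟩
    · have hvb := hv.1.resolve_left hvc
      by_cases hub : u ∈ bagAt G c
      · exact ⟨⟨lo, hlo⟩, ⟨Or.inr hub, hu.2⟩, ⟨Or.inr hvb, hv.2⟩⟩
      · rcases h2 u (hu.1.resolve_right hub) v hvb hv.2 huf with h | h
        · exact absurd h hvc
        · exact absurd h hub
  have hmem : ∀ u ∈ (chain G lo hi ∪ bagAt G c) ∩ B, ∃ i : chain G lo hi,
      u ∈ (bagAt G i ∪ bagAt G c) ∩ B := by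
    rintro u ⟨hu | hu, huB⟩
    · exact ⟨⟨u, hu⟩, Or.inl (Or.inl rfl), huB⟩
    · exact ⟨⟨lo, hlo⟩, Or.inr hu, huB⟩
  refine ⟨chain G lo hi, inferInstance, inferInstance,
    fun i => (bagAt G i ∪ bagAt G c) ∩ B, ?_, ?_, hmem, ?_, ?_, ?_, ?_⟩
  · rintro ⟨i, hi⟩ u ⟨(rfl | hu) | hu, huB⟩
    · exact ⟨Or.inl hi, huB⟩
    · exact ⟨h1 i hi u hu huB, huB⟩
    · exact ⟨Or.inr hu, huB⟩
  · intro i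
    exact (encard_le_encard inter_subset_left).trans (encard_bagAt_union_le hk _ _)
  · intro u hu v hv huv
    rcases lt_trichotomy u v with h | rfl | h
    · exact hlt u hu v hv h (hadj u v huv h)
    · obtain ⟨i, hi⟩ := hmem u hu
      exact ⟨i, hi, hi⟩
    · obtain ⟨i, h1, h2⟩ := hlt v hv u hu h (hadj v u (hsymm _ _ huv) h)
      exact ⟨i, h2, h1⟩
  · rintro v ⟨i, hi⟩ ⟨j, hj⟩ ⟨l, hl⟩ hij hjl ⟨hvi, hvB⟩ ⟨hvl, -⟩
    simp only [Subtype.mk_le_mk] at hij hjl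
    refine ⟨?_, hvB⟩
    rcases hvi with hvi | hvi
    swap
    · exact Or.inr hvi
    rcases hvl with hvl | hvl
    swap
    · exact Or.inr hvl
    left
    have hle : v ≤ i := by
      rcases hvi with rfl | h
      · exact le_rfl
      · exact (front_lt h).le
    rcases (hle.trans hij).eq_or_lt with rfl | hvj
    · exact Or.inl rfl
    · right
      rcases hvl with rfl | hvl
      · exact absurd hjl (not_le.2 hvj)
      · exact mem_front_of_lt (mem_cone_of_mem_of_le hj.2 hl.2 hjl) hvl hvj
  · exact ⟨⟨lo, hlo⟩, fun j => Subtype.coe_le_coe.1 (le_of_mem_cone j.2.1),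
      fun u hu => ⟨Or.inr hu.1, hu.2⟩⟩
  · exact ⟨⟨hi, hhi'⟩, fun j => Subtype.coe_le_coe.1 (le_of_mem_cone j.2.2), subset_rfl⟩

/-- A set of vertices lying above `y` or `x` is laid out from `y` to `x`. -/
theorem hasLayout_two_chains [Finite V] (hk : ∀ v, (front G v).encard ≤ k)
    (hsymm : ∀ u v, adj u v → adj v u)
    (hadj : ∀ u v, adj u v → u < v → u ∈ front G v) (hy : y ∈ cone G r) (hx : x ∈ cone G r)
    (hB : B ⊆ cone G r) (hBxy : ∀ v ∈ B, y ∈ cone G v ∨ x ∈ cone G v) :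
    HasLayout (2 * k + 2 : ℕ) adj B (bagAt G y ∩ B) (bagAt G x ∩ B) := by
  -- `c` is the lowest common ancestor of `x` and `y`. Its bag is kept throughout, which costs the
  -- factor two, and so the chains from `y` up to `c`, between `r` and `c`, and from `c` down to `x`
  -- can be glued in this order.
  obtain ⟨c, ⟨hcr, hcy, hcx⟩, hmax⟩ := (Set.toFinite
    {v | v ∈ cone G r ∧ y ∈ cone G v ∧ x ∈ cone G v}).exists_maximalFor id _
      ⟨r, self_mem_cone r, hy, hx⟩
  have hmax' : ∀ v, v ∈ cone G r → y ∈ cone G v → x ∈ cone G v → v ≤ c := by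
    intro v h1 h2 h3
    rcases le_total v c with h | h
    · exact h
    · exact hmax ⟨h1, h2, h3⟩ h
  have mem_bag : ∀ u v, v ∈ cone G c → u ∈ front G v → u ∉ bagAt G c → u ∈ cone G c ∧ u ≠ c := by
    intro u v hv hu hub
    refine ⟨(mem_cone_or_front hv hu).resolve_right fun h => hub (Or.inr h), ?_⟩
    rintro rfl
    exact hub (Or.inl rfl)
  have down : ∀ z, z ∈ cone G c → HasLayout (2 * k + 2 : ℕ) adj ((chain G c z ∪ bagAt G c) ∩ B)
      (bagAt G c ∩ B) ((bagAt G z ∪ bagAt G c) ∩ B) := by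
    intro z hz
    refine hasLayout_chain hk hsymm hadj hz ?_ ?_
    · intro v hv u hu _
      by_cases hub : u ∈ bagAt G c
      · exact Or.inr hub
      · exact Or.inl ⟨(mem_bag u v hv.1 hu hub).1, mem_cone_trans hv.2 (mem_cone_of_mem_front hu)⟩
    · rintro u hu v (rfl | hv) - huf
      · exact Or.inr (Or.inr huf)
      · exact absurd (le_of_mem_cone hu.1) (not_le.2 ((front_lt huf).trans (front_lt hv)))
  have up : HasLayout (2 * k + 2 : ℕ) adj ((chain G r c ∪ bagAt G c) ∩ B)
      (bagAt G c ∩ B) ((bagAt G c ∪ bagAt G c) ∩ B) := by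
    refine hasLayout_chain hk hsymm hadj hcr ?_ ?_
    · intro v hv u hu huB
      exact Or.inl ⟨hB huB, mem_cone_trans hv.2 (mem_cone_of_mem_front hu)⟩
    · rintro u hu v (rfl | hv) hvB huf
      · exact Or.inl ⟨hcr, self_mem_cone _⟩
      · exact Or.inl ⟨hB hvB, mem_cone_of_mem_front hv⟩
  have hdu : ∀ z, ∀ u ∈ chain G c z, u ∈ chain G r c → u ∈ bagAt G c := by
    intro z u h1 h2
    exact Or.inl (eq_of_mem_cone_of_mem_cone h1.1 h2.2)
  have cross : ∀ z, ∀ u ∈ chain G c z, ∀ v ∈ chain G r c, adj u v →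
      u ∈ bagAt G c ∨ v ∈ bagAt G c := by
    intro z u hu v hv huv
    rcases lt_trichotomy u v with h | rfl | h
    · exact absurd h (not_lt.2 ((le_of_mem_cone hv.2).trans (le_of_mem_cone hu.1)))
    · exact Or.inl (hdu z u hu hv)
    · by_contra! hc
      have := mem_bag v u hu.1 (hadj v u (hsymm _ _ huv) h) hc.2
      exact hc.2 (Or.inl (eq_of_mem_cone_of_mem_cone this.1 hv.2))
  have hyx : ∀ u ∈ chain G c y, u ∈ chain G c x → u ∈ bagAt G c := by
    intro u h1 h2
    exact Or.inl (le_antisymm (hmax' u (mem_cone_trans h1.1 hcr) h1.2 h2.2) (le_of_mem_cone h1.1))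
  have L1 := HasLayout.append hsymm (down y hcy).reverse up
    (by
      rintro u ⟨⟨hu | hu, huB⟩, ⟨hu' | hu', -⟩⟩
      · exact ⟨hdu y u hu hu', huB⟩
      · exact ⟨hu', huB⟩
      · exact ⟨hu, huB⟩
      · exact ⟨hu, huB⟩)
    (by
      rintro u ⟨⟨hu | hu, huB⟩, ⟨hu' | hu', -⟩⟩
      · exact ⟨hdu y u hu hu', huB⟩
      · exact ⟨hu', huB⟩
      · exact ⟨hu, huB⟩
      · exact ⟨hu, huB⟩)
    (by
      rintro u ⟨hu | hu, huB⟩ v ⟨hv | hv, hvB⟩ huv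
      · rcases cross y u hu v hv huv with h | h
        · exact Or.inl ⟨Or.inr h, huB⟩
        · exact Or.inr ⟨Or.inr h, hvB⟩
      · exact Or.inr ⟨Or.inr hv, hvB⟩
      · exact Or.inl ⟨Or.inr hu, huB⟩
      · exact Or.inl ⟨Or.inr hu, huB⟩)
  have hsub : ((chain G c y ∪ bagAt G c) ∩ B ∪ (chain G r c ∪ bagAt G c) ∩ B) ∩
      ((chain G c x ∪ bagAt G c) ∩ B) ⊆ bagAt G c ∩ B := by
    rintro u ⟨⟨hu | hu, huB⟩ | ⟨hu | hu, huB⟩, ⟨hu' | hu', -⟩⟩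
    · exact ⟨hyx u hu hu', huB⟩
    · exact ⟨hu', huB⟩
    · exact ⟨hu, huB⟩
    · exact ⟨hu, huB⟩
    · exact ⟨hdu x u hu' hu, huB⟩
    · exact ⟨hu', huB⟩
    · exact ⟨hu, huB⟩
    · exact ⟨hu, huB⟩
  have cross' : ∀ u ∈ chain G c y, ∀ v ∈ chain G c x, adj u v →
      u ∈ bagAt G c ∨ v ∈ bagAt G c := by
    intro u hu v hv huv
    rcases lt_trichotomy u v with h | rfl | h
    · have h1 : v ∈ cone G u := mem_cone_of_mem_front (hadj u v huv h)
      exact Or.inl (hyx u hu ⟨hu.1, mem_cone_trans hv.2 h1⟩)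
    · exact Or.inl (hyx u hu hv)
    · have h1 : u ∈ cone G v := mem_cone_of_mem_front (hadj v u (hsymm _ _ huv) h)
      exact Or.inr (hyx v ⟨hv.1, mem_cone_trans hu.2 h1⟩ hv)
  have L2 := HasLayout.append hsymm L1 (down x hcx)
    (hsub.trans (by rw [union_self]))
    hsub
    (by
      rintro u (⟨hu | hu, huB⟩ | ⟨hu | hu, huB⟩) v ⟨hv | hv, hvB⟩ huv
      · rcases cross' u hu v hv huv with h | h
        · exact Or.inl ⟨Or.inr h, huB⟩
        · exact Or.inr (Or.inl ⟨Or.inr h, hvB⟩)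
      · exact Or.inr (Or.inl ⟨Or.inr hv, hvB⟩)
      · exact Or.inl ⟨Or.inr hu, huB⟩
      · exact Or.inl ⟨Or.inr hu, huB⟩
      · rcases cross x v hv u hu (hsymm _ _ huv) with h | h
        · exact Or.inr (Or.inl ⟨Or.inr h, hvB⟩)
        · exact Or.inl ⟨Or.inr h, huB⟩
      · exact Or.inr (Or.inl ⟨Or.inr hv, hvB⟩)
      · exact Or.inl ⟨Or.inr hu, huB⟩
      · exact Or.inl ⟨Or.inr hu, huB⟩)
  have hall : ((chain G c y ∪ bagAt G c) ∩ B ∪ (chain G r c ∪ bagAt G c) ∩ B) ∪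
      ((chain G c x ∪ bagAt G c) ∩ B) = B := by
    apply subset_antisymm
    · rintro u ((hu | hu) | hu) <;> exact hu.2
    · intro u hu
      rcases hBxy u hu with h | h
      · rcases mem_cone_or_mem_cone hcy h with h' | h'
        · exact Or.inl (Or.inl ⟨Or.inl ⟨h', h⟩, hu⟩)
        · exact Or.inl (Or.inr ⟨Or.inl ⟨hB hu, h'⟩, hu⟩)
      · rcases mem_cone_or_mem_cone hcx h with h' | h'
        · exact Or.inr ⟨Or.inl ⟨h', h⟩, hu⟩
        · exact Or.inl (Or.inr ⟨Or.inl ⟨hB hu, h'⟩, hu⟩)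
  rw [hall] at L2
  exact L2.mono (inter_subset_inter_left _ subset_union_left)
    (inter_subset_inter_left _ subset_union_left)

end Chains

/-! ### Laying out a prefix of cuts from `p` to `q` -/

section Cuts

variable {V : Type u} [LinearOrder V] {G : SimpleGraph V} {k : ℕ}
  {B E : Set V} {p q r x y z u v w : V}

/-- The topmost vertices of `cone G r` outside `E`. -/
def IsChild (G : SimpleGraph V) (r : V) (E : Set V) (w : V) : Prop :=
  w ∈ cone G r ∧ w ∉ E ∧ ∀ u ∈ cone G r, w ∈ cone G u → u ≠ w → u ∈ E

/-- The adjacency of the graph obtained from `G` by making the front of every child a clique. -/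
def childAdj (G : SimpleGraph V) (r : V) (E : Set V) (u v : V) : Prop :=
  G.Adj u v ∨ ∃ w, IsChild G r E w ∧ u ∈ front G w ∧ v ∈ front G w

theorem childAdj_symm (u v : V) (h : childAdj G r E u v) : childAdj G r E v u := by
  rcases h with h | ⟨w, hw, h1, h2⟩
  · exact Or.inl h.symm
  · exact Or.inr ⟨w, hw, h2, h1⟩

/-- Fronts are chains, so the added cliques still join comparable vertices only. This makes the
chain layouts applicable to `childAdj`. -/
theorem mem_front_of_childAdj (u v : V) (h : childAdj G r E u v) (huv : u < v) :
    u ∈ front G v := by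
  rcases h with h | ⟨w, hw, h1, h2⟩
  · exact mem_front_of_adj (self_mem_cone v) h.symm huv
  · exact mem_front_of_mem_front h1 h2 huv

/-- A prefix of `cone G r`: it contains `r` and is closed under going up. -/
structure IsPrefix (G : SimpleGraph V) (r : V) (E : Set V) : Prop where
  subset : E ⊆ cone G r
  root_mem : r ∈ E
  up : ∀ x ∈ E, ∀ u ∈ cone G r, x ∈ cone G u → u ∈ E

/-- The region between `p` and `q`. -/
def region (G : SimpleGraph V) (r p q : V) : Set V := cone G r ∪ {p, q}

/-- A prefix all of whose members other than the root cut `p` from `q`. -/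
structure IsCutPrefix (G : SimpleGraph V) (r p q : V) (E : Set V) : Prop extends
    IsPrefix G r E where
  joined : JoinedIn G (region G r p q) p q
  left_notMem : p ∉ cone G r
  right_notMem : q ∉ cone G r
  cut : ∀ x ∈ E, x ≠ r → ¬ JoinedIn G (region G r p q \ cone G x) p q

/-- The part of the region on the side of `p` of the cut at `x`. -/
def leftSide (G : SimpleGraph V) (r p q x : V) : Set V :=
  {u | JoinedIn G (region G r p q \ cone G x) p u}

/-- The lowest members of `E`, apart from the root. -/
def IsLeaf (G : SimpleGraph V) (r : V) (E : Set V) (x : V) : Prop :=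
  x ∈ E ∧ x ≠ r ∧ ∀ z ∈ E, z ∈ cone G x → z = x

theorem left_mem_leftSide (h : IsCutPrefix G r p q E) (hx : x ∈ E) : p ∈ leftSide G r p q x :=
  JoinedIn.refl ⟨Or.inr (Or.inl rfl),
    fun hc => h.left_notMem (cone_subset (h.subset hx) hc)⟩

theorem IsLeaf.disjoint (hx : IsLeaf G r E x) (hy : IsLeaf G r E y) (hxy : x ≠ y)
    (hux : u ∈ cone G x) : u ∉ cone G y := by
  intro huy
  rcases mem_cone_or_mem_cone hux huy with h | h
  · exact hxy (hx.2.2 y hy.1 h).symm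
  · exact hxy (hy.2.2 x hx.1 h)

/-- A cone that avoids the cut at `x` lies on one side. -/
theorem cone_subset_leftSide (hz : z ∈ cone G r) (hd : ∀ u ∈ cone G z, u ∉ cone G x)
    (hu : u ∈ cone G z) (hul : u ∈ leftSide G r p q x) : cone G z ⊆ leftSide G r p q x := by
  intro v hv
  exact JoinedIn.trans hul ((connSet_cone z).joinedIn_of_subset
    (fun w hw => ⟨Or.inl (cone_subset hz hw), hd w hw⟩) hu hv)

/-- Followed from `q`, a connection to `p` first meets one of the two cones, say that of `x`. If `x`
is on the left of `y`, then `p` and `q` are joined through `cone G x` while avoiding `cone G y`,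
which is a cut. -/
theorem leftSide_antisymm (h : IsCutPrefix G r p q E) (hx : IsLeaf G r E x)
    (hy : IsLeaf G r E y) (hyx : y ∈ leftSide G r p q x) : x ∉ leftSide G r p q y := by
  intro hxy
  have hne : x ≠ y := by
    rintro rfl
    exact hyx.right_mem.2 (self_mem_cone x)
  have key : ∀ a b : V, IsLeaf G r E a → IsLeaf G r E b → a ≠ b → a ∈ leftSide G r p q b →
      ∀ z ∈ cone G a, (q = z ∨ ∃ y, JoinedIn G (region G r p q \ (cone G a ∪ cone G b)) q y ∧
        G.Adj y z) → False := by
    intro a b ha hb hab hl z hz hq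
    have haR := h.subset ha.1
    have hsub : cone G a ⊆ region G r p q \ cone G b := fun w hw =>
      ⟨Or.inl (cone_subset haR hw), ha.disjoint hb hab hw⟩
    have hpz : JoinedIn G (region G r p q \ cone G b) p z :=
      JoinedIn.trans hl ((connSet_cone a).joinedIn_of_subset hsub (self_mem_cone a) hz)
    rcases hq with rfl | ⟨y, hy, hyz⟩
    · exact h.right_notMem (cone_subset haR hz)
    · have h1 : JoinedIn G (region G r p q \ cone G b) q y :=
        hy.mono fun w hw => ⟨hw.1, fun hc => hw.2 (Or.inr hc)⟩
      exact h.cut b hb.1 hb.2.1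
        (hpz.trans ((JoinedIn.of_adj hyz.symm (hsub hz) h1.right_mem).trans h1.symm))
  obtain ⟨z, hz, -, hzq⟩ := h.joined.symm.exists_first (cone G x ∪ cone G y)
    (fun hc => h.cut x hx.1 hx.2.1
      (hc.symm.mono fun w hw => ⟨hw.1, fun hc => hw.2 (Or.inl hc)⟩))
  rcases hz with hz | hz
  · exact key x y hx hy hne hxy z hz hzq
  · exact key y x hy hx hne.symm hyx z hz (by rwa [union_comm])

/-- If the left side of `y` met `cone G x`, it would contain that whole cone, against
`leftSide_antisymm`. -/
theorem leftSide_subset (h : IsCutPrefix G r p q E) (hx : IsLeaf G r E x)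
    (hy : IsLeaf G r E y) (hyx : y ∈ leftSide G r p q x) :
    leftSide G r p q y ⊆ leftSide G r p q x := by
  have hne : x ≠ y := by
    rintro rfl
    exact hyx.right_mem.2 (self_mem_cone x)
  have hd : ∀ u ∈ leftSide G r p q y, u ∉ cone G x := by
    intro u hu hux
    exact leftSide_antisymm h hx hy hyx (cone_subset_leftSide (h.subset hx.1)
      (fun w hw => hx.disjoint hy hne hw) hux hu (self_mem_cone x))
  intro u hu
  have h1 := (JoinedIn.connSet_component (G := G) (A := region G r p q \ cone G y) p) p
    (left_mem_leftSide h hy.1) u hu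
  exact h1.mono fun w hw => ⟨(JoinedIn.right_mem hw).1, hd w hw⟩

/-- If `y` is not on the left of `x`, the left side of `x` avoids `cone G y`. The beginning of a
connection from `p` to `q`, up to `cone G x`, then places `x` on the left of `y`. -/
theorem leftSide_total (h : IsCutPrefix G r p q E) (hx : IsLeaf G r E x)
    (hy : IsLeaf G r E y) (hxy : x ≠ y) (hyx : y ∉ leftSide G r p q x) :
    x ∈ leftSide G r p q y := by
  have hd : ∀ u ∈ leftSide G r p q x, u ∉ cone G y := by
    intro u hu huy
    exact hyx (cone_subset_leftSide (h.subset hy.1)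
      (fun w hw => hy.disjoint hx hxy.symm hw) huy hu (self_mem_cone y))
  obtain ⟨z, hz, -, hzp⟩ := h.joined.exists_first (cone G x) (h.cut x hx.1 hx.2.1)
  have hsub : cone G x ⊆ region G r p q \ cone G y := fun w hw =>
    ⟨Or.inl (cone_subset (h.subset hx.1) hw), hx.disjoint hy hxy hw⟩
  rcases hzp with rfl | ⟨a, ha, haz⟩
  · exact absurd (cone_subset (h.subset hx.1) hz) h.left_notMem
  · have h1 : a ∈ leftSide G r p q y := by
      have := (JoinedIn.connSet_component (G := G) (A := region G r p q \ cone G x) p) p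
        (left_mem_leftSide h hx.1) a ha
      exact this.mono fun w hw => ⟨(JoinedIn.right_mem hw).1, hd w hw⟩
    exact JoinedIn.trans h1 ((JoinedIn.of_adj haz h1.right_mem (hsub hz)).trans
      ((connSet_cone x).joinedIn_of_subset hsub hz (self_mem_cone x)))

theorem exists_leaf [Finite V] (hEr : E ≠ {r}) (h : IsPrefix G r E) (hv : v ∈ E) :
    ∃ z ∈ cone G v, IsLeaf G r E z := by
  obtain ⟨z, ⟨hzE, hzv⟩, hmax⟩ := (Set.toFinite (E ∩ cone G v)).exists_maximalFor id _
    ⟨v, hv, self_mem_cone v⟩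
  have hleaf : ∀ a ∈ E, a ∈ cone G z → a = z := fun a ha haz =>
    le_antisymm (hmax ⟨ha, cone_subset hzv haz⟩ (le_of_mem_cone haz)) (le_of_mem_cone haz)
  refine ⟨z, hzv, hzE, ?_, hleaf⟩
  rintro rfl
  exact hEr (subset_antisymm (fun a ha => hleaf a ha (h.subset ha)) (by simpa using hzE))

/-- The leaf `y` is the only member of `E` in its cone, so the two pieces meet in `y` alone. An edge
between them that neither sees comes from the front of a child below `y`, and then both ends lie in
`front G y`; an extra bag in the middle takes care of these edges. -/
theorem hasLayout_extend (hk : ∀ v, (front G v).encard ≤ k) (h : IsCutPrefix G r p q E)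
    (hy : IsLeaf G r E y) {Y : Set V} (hB : B ⊆ E \ leftSide G r p q y) (hyB : y ∈ B)
    (h1 : HasLayout (2 * k + 2 : ℕ) (childAdj G r E) (E ∩ (leftSide G r p q y ∪ cone G y)) ∅
      (bagAt G y ∩ (E ∩ (leftSide G r p q y ∪ cone G y))))
    (h2 : HasLayout (2 * k + 2 : ℕ) (childAdj G r E) B (bagAt G y ∩ B) Y) :
    HasLayout (2 * k + 2 : ℕ) (childAdj G r E)
      (E ∩ (leftSide G r p q y ∪ cone G y) ∪ B) ∅ Y := by
  set A := E ∩ (leftSide G r p q y ∪ cone G y) with hA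
  have hyb : y ∈ bagAt G y := Or.inl rfl
  have hAB : ∀ u ∈ A, u ∈ B → u = y := by
    rintro u ⟨huE, hu | hu⟩ huB
    · exact absurd hu (hB huB).2
    · exact hy.2.2 u huE hu
  have cross : ∀ u ∈ A, ∀ v ∈ B, childAdj G r E u v →
      v ∈ A ∨ u ∈ B ∨ (u ∈ bagAt G y ∧ v ∈ bagAt G y) := by
    rintro u ⟨huE, hu⟩ v hv huv
    rcases hu with hu | hu
    swap
    · exact Or.inr (Or.inl (hy.2.2 u huE hu ▸ hyB))
    by_cases hvy : v ∈ cone G y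
    · exact Or.inl ⟨(hB hv).1, Or.inr hvy⟩
    have hvR : v ∈ region G r p q \ cone G y := ⟨Or.inl (h.subset (hB hv).1), hvy⟩
    rcases huv with huv | ⟨w, hw, huw, hvw⟩
    · exact Or.inl ⟨(hB hv).1, Or.inl
        (JoinedIn.trans hu (JoinedIn.of_adj huv (JoinedIn.right_mem hu) hvR))⟩
    · by_cases hwy : w ∈ cone G y
      · refine Or.inr (Or.inr ⟨Or.inr ?_, Or.inr ?_⟩)
        · exact (mem_cone_or_front hwy huw).resolve_left (JoinedIn.right_mem hu).2
        · exact (mem_cone_or_front hwy hvw).resolve_left hvy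
      · have hsub : cone G w ⊆ region G r p q \ cone G y := by
          refine fun a ha => ⟨Or.inl (cone_subset hw.1 ha), fun hay => ?_⟩
          rcases mem_cone_or_mem_cone ha hay with h' | h'
          · exact hw.2.1 (h.up y hy.1 w hw.1 h')
          · exact hwy h'
        obtain ⟨-, a, ha, hau⟩ := huw
        obtain ⟨-, b, hb, hbv⟩ := hvw
        refine Or.inl ⟨(hB hv).1, Or.inl ?_⟩
        exact JoinedIn.trans hu ((JoinedIn.of_adj hau.symm (JoinedIn.right_mem hu) (hsub ha)).trans
          (((connSet_cone w).joinedIn_of_subset hsub ha hb).trans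
            (JoinedIn.of_adj hbv (hsub hb) hvR)))
  set K := bagAt G y ∩ (A ∪ B) with hK
  have hKcard : K.encard ≤ ((2 * k + 2 : ℕ) : ℕ∞) :=
    (encard_le_encard (inter_subset_left.trans subset_union_left)).trans
      (encard_bagAt_union_le hk y y)
  have L1 := HasLayout.append childAdj_symm h1 (HasLayout.single (adj := childAdj G r E) hKcard)
    (fun u hu => ⟨hu.2.1, hu.1⟩) (fun u hu => hu.2)
    (by
      rintro u hu v ⟨hvb, hv | hv⟩ huv
      · exact Or.inr hv
      · rcases cross u hu v hv huv with h' | h' | h'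
        · exact Or.inr h'
        · exact Or.inl ⟨hAB u hu h' ▸ hyb, Or.inl hu⟩
        · exact Or.inl ⟨h'.1, Or.inl hu⟩)
  have L2 := HasLayout.append childAdj_symm L1 h2
    (by
      rintro u ⟨hu | hu, huB⟩
      · exact ⟨hAB u hu huB ▸ hyb, Or.inr huB⟩
      · exact hu)
    (by
      rintro u ⟨hu | hu, huB⟩
      · exact ⟨hAB u hu huB ▸ hyb, huB⟩
      · exact ⟨hu.1, huB⟩)
    (by
      have hmain : ∀ u ∈ A, ∀ v ∈ B, childAdj G r E u v → u ∈ B ∨ v ∈ A ∪ K := by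
        intro u hu v hv huv
        rcases cross u hu v hv huv with h' | h' | h'
        · exact Or.inr (Or.inl h')
        · exact Or.inl h'
        · exact Or.inr (Or.inr ⟨h'.2, Or.inr hv⟩)
      rintro u (hu | ⟨hub, hu | hu⟩) v hv huv
      · exact hmain u hu v hv huv
      · exact hmain u hu v hv huv
      · exact Or.inl hu)
  have : A ∪ K ∪ B = A ∪ B := by
    apply subset_antisymm
    · rintro u ((hu | hu) | hu)
      · exact Or.inl hu
      · exact hu.2
      · exact Or.inr hu
    · rintro u (hu | hu)
      · exact Or.inl (Or.inl hu)
      · exact Or.inr hu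
  rwa [this] at L2

/-- The vertices of `E` between two consecutive cuts lie above one of the two. -/
theorem mem_cone_of_mem_gap [Finite V] (hEr : E ≠ {r}) (h : IsCutPrefix G r p q E)
    (hx : IsLeaf G r E x) (hv : v ∈ E) (hvx : v ∈ leftSide G r p q x ∪ cone G x)
    (hxv : x ∉ cone G v) :
    ∃ z ∈ cone G v, IsLeaf G r E z ∧ z ∈ leftSide G r p q x := by
  obtain ⟨z, hzv, hz⟩ := exists_leaf hEr h.toIsPrefix hv
  refine ⟨z, hzv, hz, ?_⟩
  rcases hvx with hvx | hvx
  · refine cone_subset_leftSide (h.subset hv) ?_ (self_mem_cone v) hvx hzv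
    intro u hu hux
    rcases mem_cone_or_mem_cone hu hux with h' | h'
    · exact hxv h'
    · exact hxv (hx.2.2 v hv h' ▸ self_mem_cone _)
  · exact absurd (hx.2.2 v hv hvx ▸ self_mem_cone _) hxv

theorem mem_cone_of_not_left [Finite V] (h : IsCutPrefix G r p q E)
    (hy : IsLeaf G r E y) (hv : v ∈ E) (hvy : v ∉ leftSide G r p q y)
    (hzv : z ∈ cone G v) (hzy : z ∈ leftSide G r p q y) : y ∈ cone G v := by
  by_contra hyv
  refine hvy (cone_subset_leftSide (h.subset hv) ?_ hzv hzy (self_mem_cone v))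
  intro u hu huy
  rcases mem_cone_or_mem_cone hu huy with h' | h'
  · exact hyv h'
  · exact hyv (hy.2.2 v hv h' ▸ self_mem_cone _)

/-- Induction along the leaves from `p` to `q`. If `y` is the last leaf to the left of `x`, what is
added after `y` lies above `y` or `x`, since a leaf below any other vertex would lie strictly
between them. -/
theorem hasLayout_left [Finite V] (hk : ∀ v, (front G v).encard ≤ k) (hEr : E ≠ {r})
    (h : IsCutPrefix G r p q E) : ∀ (n : ℕ) (x : V), (leftSide G r p q x).ncard = n →
    IsLeaf G r E x → HasLayout (2 * k + 2 : ℕ) (childAdj G r E)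
      (E ∩ (leftSide G r p q x ∪ cone G x)) ∅
      (bagAt G x ∩ (E ∩ (leftSide G r p q x ∪ cone G x))) := by
  intro n
  induction n using Nat.strong_induction_on with
  | _ n ih =>
  intro x hn hx
  by_cases hpred : ∃ y, IsLeaf G r E y ∧ y ∈ leftSide G r p q x
  · obtain ⟨y, ⟨hy, hyx⟩, hmax⟩ := (Set.toFinite
      {y | IsLeaf G r E y ∧ y ∈ leftSide G r p q x}).exists_maximalFor
      (fun y => (leftSide G r p q y).ncard) _ hpred
    have hlt : ∀ a b, IsLeaf G r E a → IsLeaf G r E b → b ∈ leftSide G r p q a →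
        (leftSide G r p q b).ncard < (leftSide G r p q a).ncard := by
      intro a b ha hb hba
      refine Set.ncard_lt_ncard ⟨leftSide_subset h ha hb hba, fun hc => ?_⟩ (Set.toFinite _)
      exact (JoinedIn.right_mem (hc hba)).2 (self_mem_cone b)
    have hne : x ≠ y := by
      rintro rfl
      exact hyx.right_mem.2 (self_mem_cone x)
    have hxy := leftSide_antisymm h hx hy hyx
    have h1 := ih _ (hn ▸ hlt x y hx hy hyx) y rfl hy
    have h2 : HasLayout (2 * k + 2 : ℕ) (childAdj G r E)
        ((E ∩ (leftSide G r p q x ∪ cone G x)) \ leftSide G r p q y)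
        (bagAt G y ∩ ((E ∩ (leftSide G r p q x ∪ cone G x)) \ leftSide G r p q y))
        (bagAt G x ∩ ((E ∩ (leftSide G r p q x ∪ cone G x)) \ leftSide G r p q y)) := by
      refine hasLayout_two_chains hk childAdj_symm mem_front_of_childAdj (h.subset hy.1)
        (h.subset hx.1) (fun a ha => h.subset ha.1.1) ?_
      rintro v ⟨⟨hvE, hv⟩, hvy⟩
      by_contra! hc
      obtain ⟨z, hzv, hz, hzx⟩ := mem_cone_of_mem_gap hEr h hx hvE hv hc.2
      by_cases hzy : z ∈ leftSide G r p q y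
      · exact hc.1 (mem_cone_of_not_left h hy hvE hvy hzv hzy)
      · have hzne : y ≠ z := by
          rintro rfl
          exact hc.1 hzv
        have := hlt z y hz hy (leftSide_total h hy hz hzne hzy)
        exact absurd (hmax ⟨hz, hzx⟩ this.le) (not_le.2 this)
    have hyself : y ∉ leftSide G r p q y := fun hc => (JoinedIn.right_mem hc).2 (self_mem_cone y)
    have hyB : y ∈ (E ∩ (leftSide G r p q x ∪ cone G x)) \ leftSide G r p q y :=
      ⟨⟨hy.1, Or.inl hyx⟩, hyself⟩
    have h3 := hasLayout_extend hk h hy (fun a ha => ⟨ha.1.1, ha.2⟩)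
      hyB h1 h2
    have hset : E ∩ (leftSide G r p q y ∪ cone G y) ∪
        (E ∩ (leftSide G r p q x ∪ cone G x)) \ leftSide G r p q y =
        E ∩ (leftSide G r p q x ∪ cone G x) := by
      apply subset_antisymm
      · rintro a (⟨haE, ha | ha⟩ | ha)
        · exact ⟨haE, Or.inl (leftSide_subset h hx hy hyx ha)⟩
        · exact ⟨haE, Or.inl (hy.2.2 a haE ha ▸ hyx)⟩
        · exact ha.1
      · intro a ha
        by_cases hay : a ∈ leftSide G r p q y
        · exact Or.inl ⟨ha.1, Or.inl hay⟩
        · exact Or.inr ⟨ha, hay⟩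
    rw [hset] at h3
    refine h3.mono subset_rfl ?_
    -- Removing the left side of `y` takes nothing from `bagAt G x`: `x` is not there, and a vertex
    -- of `front G x` there would draw the connected `cone G x` along with it.
    rintro a ⟨hab, ha⟩
    refine ⟨hab, ha, fun hay => ?_⟩
    rcases hab with rfl | hab
    · exact hxy hay
    · obtain ⟨-, b, hb, hba⟩ := hab
      have hbR : b ∈ region G r p q \ cone G y :=
        ⟨Or.inl (cone_subset (h.subset hx.1) hb), hx.disjoint hy hne hb⟩
      have hbl : b ∈ leftSide G r p q y :=
        JoinedIn.trans hay (JoinedIn.of_adj hba.symm (JoinedIn.right_mem hay) hbR)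
      exact hxy (cone_subset_leftSide (h.subset hx.1) (fun w hw => hx.disjoint hy hne hw)
        hb hbl (self_mem_cone x))
  · refine (hasLayout_two_chains hk childAdj_symm mem_front_of_childAdj (h.subset hx.1)
      (h.subset hx.1) (fun a ha => h.subset ha.1) ?_).mono (empty_subset _) subset_rfl
    rintro v ⟨hvE, hv⟩
    left
    by_contra hc
    obtain ⟨z, hzv, hz, hzx⟩ := mem_cone_of_mem_gap hEr h hx hvE hv hc
    exact hpred ⟨z, hz, hzx⟩

/-- A prefix whose members cut `p` from `q` has a path decomposition with small bags. -/
theorem IsCutPrefix.hasLayout [Finite V] (hk : ∀ v, (front G v).encard ≤ k) (hEr : E ≠ {r})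
    (h : IsCutPrefix G r p q E) : HasLayout (2 * k + 2 : ℕ) (childAdj G r E) E ∅ ∅ := by
  obtain ⟨x, hx, hmax⟩ := (Set.toFinite {y | IsLeaf G r E y}).exists_maximalFor
    (fun y => (leftSide G r p q y).ncard) _
    (by obtain ⟨z, -, hz⟩ := exists_leaf hEr h.toIsPrefix h.root_mem; exact ⟨z, hz⟩)
  have hxself : x ∉ leftSide G r p q x := fun hc => (JoinedIn.right_mem hc).2 (self_mem_cone x)
  have h2 : HasLayout (2 * k + 2 : ℕ) (childAdj G r E) (E \ leftSide G r p q x)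
      (bagAt G x ∩ (E \ leftSide G r p q x)) (bagAt G x ∩ (E \ leftSide G r p q x)) := by
    refine hasLayout_two_chains hk childAdj_symm mem_front_of_childAdj (h.subset hx.1)
      (h.subset hx.1) (fun a ha => h.subset ha.1) ?_
    rintro v ⟨hvE, hv⟩
    left
    obtain ⟨z, hzv, hz⟩ := exists_leaf hEr h.toIsPrefix hvE
    by_cases hzx : z ∈ leftSide G r p q x
    · exact mem_cone_of_not_left h hx hvE hv hzv hzx
    · by_cases hne : x = z
      · exact hne ▸ hzv
      · have hxz := leftSide_total h hx hz hne hzx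
        have hlt : (leftSide G r p q x).ncard < (leftSide G r p q z).ncard :=
          Set.ncard_lt_ncard ⟨leftSide_subset h hz hx hxz, fun hc => hxself (hc hxz)⟩
            (Set.toFinite _)
        exact absurd (hmax hz hlt.le) (not_le.2 hlt)
  have h3 := hasLayout_extend hk h hx subset_rfl ⟨hx.1, hxself⟩
    (hasLayout_left hk hEr h _ x rfl hx) h2
  have hset : E ∩ (leftSide G r p q x ∪ cone G x) ∪ E \ leftSide G r p q x = E := by
    apply subset_antisymm
    · rintro a (ha | ha) <;> exact ha.1
    · intro a ha
      by_cases hax : a ∈ leftSide G r p q x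
      · exact Or.inl ⟨ha, Or.inl hax⟩
      · exact Or.inr ⟨ha, hax⟩
  rw [hset] at h3
  exact h3.mono subset_rfl (empty_subset _)

theorem isPrefix_singleton (r : V) : IsPrefix G r {r} where
  subset := by
    rintro x rfl
    exact self_mem_cone _
  root_mem := rfl
  up := by
    rintro x rfl u hu hxu
    exact eq_of_mem_cone_of_mem_cone hu hxu

theorem hasLayout_singleton (r : V) :
    HasLayout (2 * k + 2 : ℕ) (childAdj G r {r}) {r} ∅ ∅ := by
  refine (HasLayout.single ?_).mono (empty_subset _) (empty_subset _)
  rw [encard_singleton]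
  exact_mod_cast (by omega : 1 ≤ 2 * k + 2)

end Cuts

theorem exists_adj_of_mem_support {V : Type*} {H : SimpleGraph V} {a b x : V}
    (p : H.Walk a b) (hx : x ∈ p.support) :
    x = a ∨ ∃ y, H.Adj y x := by
  induction p with
  | nil => exact Or.inl (by simpa using hx)
  | cons h p ih =>
    simp only [SimpleGraph.Walk.support_cons, List.mem_cons] at hx
    rcases hx with rfl | hx
    · exact Or.inl rfl
    · rcases ih hx with rfl | h'
      · exact Or.inr ⟨_, h⟩
      · exact Or.inr h'

/-! ### Routing demands through the contracted cones of the children -/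

section Contraction

variable {V : Type u} [LinearOrder V] {G : SimpleGraph V} {k : ℕ}
  {E U A dip : Set V} {a b p q r x y z u v w : V}

theorem IsChild.eq_of_mem (hw : IsChild G r E w) (hz : IsChild G r E z) (hv : v ∈ cone G w)
    (hv' : v ∈ cone G z) : w = z := by
  by_contra hne
  rcases mem_cone_or_mem_cone hv hv' with h | h
  · exact hw.2.1 (hz.2.2 w hw.1 h hne)
  · exact hz.2.1 (hw.2.2 z hz.1 h (Ne.symm hne))

theorem exists_isChild [Finite V] (hv : v ∈ cone G r) (hvE : v ∉ E) :
    ∃ w, IsChild G r E w ∧ v ∈ cone G w := by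
  obtain ⟨w, ⟨hwr, hwE, hvw⟩, hmin⟩ := (Set.toFinite
    {w | w ∈ cone G r ∧ w ∉ E ∧ v ∈ cone G w}).exists_minimalFor id _
    ⟨v, hv, hvE, self_mem_cone v⟩
  refine ⟨w, ⟨hwr, hwE, fun u hu hwu hne => ?_⟩, hvw⟩
  by_contra huE
  have hle := le_of_mem_cone hwu
  exact hne (le_antisymm hle (hmin ⟨hu, huE, cone_subset hwu hvw⟩ hle))

theorem IsPrefix.notMem_cone_of_isChild (hE : IsPrefix G r E) (hw : IsChild G r E w)
    (hv : v ∈ E) : v ∉ cone G w := fun h => hw.2.1 (hE.up v hv w hw.1 h)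

open Classical in
/-- Contraction of the cones of the children. -/
noncomputable def contract (G : SimpleGraph V) (r : V) (E : Set V) (v : V) : V :=
  if h : ∃ w, IsChild G r E w ∧ v ∈ cone G w then h.choose else v

theorem contract_of_mem (hw : IsChild G r E w) (hv : v ∈ cone G w) : contract G r E v = w := by
  have h : ∃ w, IsChild G r E w ∧ v ∈ cone G w := ⟨w, hw, hv⟩
  rw [contract, dif_pos h]
  exact h.choose_spec.1.eq_of_mem hw h.choose_spec.2 hv

theorem contract_of_forall (h : ∀ w, IsChild G r E w → v ∉ cone G w) :
    contract G r E v = v := by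
  rw [contract, dif_neg]
  rintro ⟨w, hw, hv⟩
  exact h w hw hv

theorem contract_cases (v : V) :
    (IsChild G r E (contract G r E v) ∧ v ∈ cone G (contract G r E v)) ∨
      (contract G r E v = v ∧ ∀ w, IsChild G r E w → v ∉ cone G w) := by
  by_cases h : ∃ w, IsChild G r E w ∧ v ∈ cone G w
  · obtain ⟨w, hw, hv⟩ := h
    rw [contract_of_mem hw hv]
    exact Or.inl ⟨hw, hv⟩
  · push Not at h
    exact Or.inr ⟨contract_of_forall h, h⟩

/-- The graph on `U` in which the cone of every child is contracted to one vertex. -/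
def contractGraph (G : SimpleGraph V) (r : V) (E U : Set V) : SimpleGraph V where
  Adj x y := x ≠ y ∧ ∃ x' ∈ U, ∃ y' ∈ U,
    contract G r E x' = x ∧ contract G r E y' = y ∧ G.Adj x' y'
  symm := ⟨by
    rintro x y ⟨h, x', hx', y', hy', h1, h2, h3⟩
    exact ⟨h.symm, y', hy', x', hx', h2, h1, h3.symm⟩⟩
  loopless := ⟨fun x h => h.1 rfl⟩

theorem JoinedIn.contract (h : JoinedIn G A a b) (hA : A ⊆ U) :
    JoinedIn (contractGraph G r E U) (GuidedDecomp.contract G r E '' A)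
      (GuidedDecomp.contract G r E a) (GuidedDecomp.contract G r E b) := by
  refine h.induction (P := fun x => JoinedIn (contractGraph G r E U)
    (GuidedDecomp.contract G r E '' A) (GuidedDecomp.contract G r E a)
      (GuidedDecomp.contract G r E x)) ?_ ?_
  · exact JoinedIn.refl (mem_image_of_mem _ h.left_mem)
  · intro x y hx hPx hxy hy
    by_cases heq : GuidedDecomp.contract G r E x = GuidedDecomp.contract G r E y
    · rwa [← heq]
    · exact hPx.trans (JoinedIn.of_adj ⟨heq, x, hA hx.right_mem, y, hA hy, rfl, rfl, hxy⟩
        (mem_image_of_mem _ hx.right_mem) (mem_image_of_mem _ hy))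

theorem contractGraph_adj_of_not (hx : ¬ IsChild G r E x) (hy : ¬ IsChild G r E y)
    (h : (contractGraph G r E U).Adj x y) : G.Adj x y := by
  obtain ⟨-, x', -, y', -, rfl, rfl, hadj⟩ := h
  rcases contract_cases (G := G) (r := r) (E := E) x' with h1 | h1
  · exact absurd h1.1 hx
  rcases contract_cases (G := G) (r := r) (E := E) y' with h2 | h2
  · exact absurd h2.1 hy
  rwa [h1.1, h2.1]

theorem mem_front_of_contractGraph_adj (hw : IsChild G r E w) (hy : ¬ IsChild G r E y)
    (h : (contractGraph G r E U).Adj w y) : y ∈ front G w := by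
  obtain ⟨hne, x', -, y', -, rfl, rfl, hadj⟩ := h
  rcases contract_cases (G := G) (r := r) (E := E) y' with h2 | h2
  · exact absurd h2.1 hy
  rcases contract_cases (G := G) (r := r) (E := E) x' with h1 | h1
  · rw [h2.1]
    exact ⟨h2.2 _ hw, x', h1.2, hadj⟩
  · exact absurd (by rw [h1.1]; exact self_mem_cone _) (h1.2 _ hw)

/-- Given an edge between the two cones, its end in the cone of the larger child would also belong
to the cone of the smaller one. So a path in the contraction enters and leaves each child through
vertices of its front. -/
theorem not_contractGraph_adj (hw : IsChild G r E w) (hz : IsChild G r E z) :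
    ¬ (contractGraph G r E U).Adj w z := by
  intro h
  have hne := h.1
  have key : ∀ w z x' y' : V, IsChild G r E w → IsChild G r E z → w ≠ z →
      contract G r E x' = w → contract G r E y' = z → G.Adj x' y' → w ≤ z → False := by
    rintro w z x' y' hw hz hne rfl rfl hadj hle
    have mem : ∀ v, IsChild G r E (contract G r E v) → v ∈ cone G (contract G r E v) := by
      intro v hv
      rcases contract_cases (G := G) (r := r) (E := E) v with h1 | h1
      · exact h1.2
      · exact absurd (by rw [h1.1]; exact self_mem_cone _) (h1.2 _ hv)
    exact hne (hw.eq_of_mem hz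
      (mem_cone_of_adj (mem x' hw) hadj (hle.trans (le_of_mem_cone (mem y' hz)))) (mem y' hz))
  obtain ⟨-, x', -, y', -, h1, h2, hadj⟩ := h
  rcases le_total w z with hle | hle
  · exact key w z x' y' hw hz hne h1 h2 hadj hle
  · exact key z w y' x' hz hw hne.symm h2 h1 hadj.symm hle

theorem not_isChild_of_mem_front (ha : a ∈ front G r) : ¬ IsChild G r E a := fun h =>
  ha.1 h.1

theorem contract_of_mem_front (ha : a ∈ front G r) : contract G r E a = a :=
  contract_of_forall fun _ hw h => ha.1 (cone_subset hw.1 h)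

theorem joinedIn_region (ha : a ∈ front G r) (hb : b ∈ front G r) :
    JoinedIn G (region G r a b) a b := by
  obtain ⟨-, x, hx, hxa⟩ := ha
  obtain ⟨-, y, hy, hyb⟩ := hb
  exact (JoinedIn.of_adj hxa.symm (Or.inr (Or.inl rfl)) (Or.inl hx)).trans
    (((connSet_cone r).joinedIn_of_subset subset_union_left hx hy).trans
      (JoinedIn.of_adj hyb (Or.inl hy) (Or.inr (Or.inr rfl))))

/-- A connection from `a` to `b` through `E` that passes once through the cone of each child in
`dip`. -/
def Route (G : SimpleGraph V) (r : V) (E : Set V) (a b : V) (dip : Set V) : Prop :=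
  ∃ (f g : V → V) (B : Set V),
    (∀ w ∈ dip, IsChild G r E w ∧ f w ∈ front G w ∧ g w ∈ front G w ∧ f w ∈ B ∧ g w ∈ B) ∧
    B ⊆ E ∪ {a, b} ∧ a ∈ B ∧ b ∈ B ∧
    ∀ K : V → Set V, (∀ w ∈ dip, ConnSet G (K w) ∧ f w ∈ K w ∧ g w ∈ K w) →
      ConnSet G (B ∪ ⋃ w ∈ dip, K w)

/-- `f w` and `g w` are the neighbours of `w` on the path. The sets `K w` joining them stay
arbitrary, because they are only supplied by the recursion into the children. -/
theorem route_of_path [Finite V] (ha : a ∈ front G r) (hb : b ∈ front G r)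
    (p : (contractGraph G r E (region G r a b)).Walk a b) (hp : p.IsPath) :
    Route G r E a b {w | w ∈ p.support ∧ IsChild G r E w} := by
  obtain ⟨f, g, hfg, hK⟩ := exists_substitution (G := G) (W := {w | IsChild G r E w})
    (F := front G) (fun x y => contractGraph_adj_of_not) (fun w y => mem_front_of_contractGraph_adj)
    (fun w w' => not_contractGraph_adj) (b := b) (not_isChild_of_mem_front hb) p hp
    (not_isChild_of_mem_front ha)
  refine ⟨f, g, {x | x ∈ p.support ∧ ¬ IsChild G r E x}, ?_, ?_, ?_, ?_, ?_⟩
  · rintro w ⟨hw, hwc⟩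
    obtain ⟨h1, h2, h3, h4⟩ := hfg w hw hwc
    exact ⟨hwc, h1, h2, h3, h4⟩
  · rintro x ⟨hx, hxc⟩
    rcases exists_adj_of_mem_support p hx with rfl | ⟨y, -, y', -, x', hx', -, rfl, -⟩
    · exact Or.inr (Or.inl rfl)
    · rcases contract_cases (G := G) (r := r) (E := E) x' with h1 | ⟨h1, h2⟩
      · exact absurd h1.1 hxc
      · rw [h1]
        rcases hx' with hx' | hx'
        · by_cases hxE : x' ∈ E
          · exact Or.inl hxE
          · obtain ⟨w, hw, hxw⟩ := exists_isChild hx' hxE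
            exact absurd hxw (h2 w hw)
        · exact Or.inr hx'
  · exact ⟨p.start_mem_support, not_isChild_of_mem_front ha⟩
  · exact ⟨p.end_mem_support, not_isChild_of_mem_front hb⟩
  · intro K hKc
    exact connSet_of_joined a (hK K fun w hw hwc => hKc w ⟨hw, hwc⟩)

theorem exists_route [Finite V] (E : Set V) (ha : a ∈ front G r) (hb : b ∈ front G r) :
    ∃ dip, Route G r E a b dip := by
  classical
  obtain ⟨p, -⟩ := (joinedIn_region ha hb).contract (r := r) (E := E) subset_rfl
  rw [contract_of_mem_front ha, contract_of_mem_front hb] at p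
  exact ⟨_, route_of_path ha hb p.bypass p.bypass_isPath⟩

theorem route_refl (E : Set V) (a : V) : Route G r E a a ∅ := by
  refine ⟨id, id, {a}, by simp, by simp, rfl, rfl, fun K _ => ?_⟩
  refine connSet_of_joined a ?_
  rintro x (hx | hx)
  · rw [mem_singleton_iff] at hx
    subst hx
    exact JoinedIn.refl (Or.inl rfl)
  · simp at hx

/-- A connection avoiding `cone G w` contracts to one avoiding the vertex `w`, so no child separates
`a` from `b` in the contraction and `exists_two_paths` applies. -/
theorem exists_two_routes [Finite V] (ha : a ∈ front G r) (hb : b ∈ front G r)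
    (h : ∀ w, IsChild G r E w → JoinedIn G (region G r a b \ cone G w) a b) :
    ∃ d₁ d₂, Route G r E a b d₁ ∧ Route G r E a b d₂ ∧ ∀ w ∈ d₁, w ∉ d₂ := by
  have h0 := (joinedIn_region ha hb).contract (r := r) (E := E) subset_rfl
  rw [contract_of_mem_front ha, contract_of_mem_front hb] at h0
  obtain ⟨p, p', hp, hp', hpp⟩ := exists_two_paths (W := {w | IsChild G r E w})
    (not_isChild_of_mem_front ha) (not_isChild_of_mem_front hb) (h0.mono (subset_univ _))
    (by
      intro w hw
      have h1 := (h w hw).contract (r := r) (E := E) (sdiff_subset (s := region G r a b))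
      rw [contract_of_mem_front ha, contract_of_mem_front hb] at h1
      refine h1.mono ?_
      rintro _ ⟨x, hx, rfl⟩ hxw
      rw [mem_singleton_iff] at hxw
      rcases contract_cases (G := G) (r := r) (E := E) x with h2 | h2
      · exact hx.2 (hxw ▸ h2.2)
      · have hxw' : x = w := h2.1.symm.trans hxw
        exact hx.2 (hxw' ▸ self_mem_cone x))
  exact ⟨_, _, route_of_path ha hb p hp, route_of_path ha hb p' hp',
    fun w hw hw' => hpp w hw.2 hw.1 hw'.1⟩

/-- The prefix of `cone G r` formed by the cones that cut `p` from `q`. -/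
def cutPrefix (G : SimpleGraph V) (r p q : V) : Set V :=
  {x | x ∈ cone G r ∧ (x = r ∨ ¬ JoinedIn G (region G r p q \ cone G x) p q)}

theorem isCutPrefix_cutPrefix (hp : p ∈ front G r) (hq : q ∈ front G r) :
    IsCutPrefix G r p q (cutPrefix G r p q) where
  subset := fun _ hx => hx.1
  root_mem := ⟨self_mem_cone r, Or.inl rfl⟩
  up := by
    rintro x ⟨hxr, hx⟩ u hu hxu
    refine ⟨hu, ?_⟩
    rcases hx with rfl | hx
    · exact Or.inl (eq_of_mem_cone_of_mem_cone hu hxu)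
    · exact Or.inr fun hc => hx (hc.mono (sdiff_subset_sdiff_right (cone_subset hxu)))
  joined := joinedIn_region hp hq
  left_notMem := hp.1
  right_notMem := hq.1
  cut := fun x hx hxr => hx.2.resolve_left hxr

/-- The largest number of guidance paths that may pass through a cone. -/
def loadBound (k : ℕ) : ℕ := k ^ 2 * (2 * k - 1)

/-- One step of the construction: a part `E` below `r` and a routing of all demands such that no
child receives too many of them. -/
theorem exists_step [Finite V] (hk : ∀ v, (front G v).encard ≤ k) (r : V) {L : Type*}
    (D : Finset L) (s t : L → V) (hD : ∀ δ ∈ D, s δ ∈ front G r ∧ t δ ∈ front G r)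
    (hcard : D.card ≤ loadBound k + k) :
    ∃ E, IsPrefix G r E ∧ HasLayout (2 * k + 2 : ℕ) (childAdj G r E) E ∅ ∅ ∧
      ∃ dip : L → Set V, (∀ δ ∈ D, Route G r E (s δ) (t δ) (dip δ)) ∧
        ∀ w, IsChild G r E w → {δ | δ ∈ D ∧ w ∈ dip δ}.ncard ≤ loadBound k := by
  classical
  have hroute : ∀ E : Set V, ∃ dip : L → Set V, ∀ δ ∈ D, Route G r E (s δ) (t δ) (dip δ) := by
    intro E
    have : ∀ δ, ∃ d, δ ∈ D → Route G r E (s δ) (t δ) d := by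
      intro δ
      by_cases h : δ ∈ D
      · obtain ⟨d, hd⟩ := exists_route E (hD δ h).1 (hD δ h).2
        exact ⟨d, fun _ => hd⟩
      · exact ⟨∅, fun h' => absurd h' h⟩
    choose dip hdip using this
    exact ⟨dip, hdip⟩
  have hcount : ∀ (D₀ : Finset L) (P : L → Prop), D₀ ⊆ D → (∀ δ ∈ D₀, ¬ P δ) →
      {δ | δ ∈ D ∧ P δ}.ncard ≤ D.card - D₀.card := by
    intro D₀ P hsub hP
    rw [← Finset.card_sdiff_of_subset hsub, ← Set.ncard_coe_finset]
    refine Set.ncard_le_ncard ?_ (Finset.finite_toSet _)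
    rintro δ ⟨hδ, hPδ⟩
    simp only [Finset.coe_sdiff, mem_sdiff, Finset.mem_coe]
    exact ⟨hδ, fun h => hP δ h hPδ⟩
  by_cases hle : D.card ≤ loadBound k
  · obtain ⟨dip, hdip⟩ := hroute {r}
    refine ⟨{r}, isPrefix_singleton r, hasLayout_singleton r, dip, hdip, fun w _ => ?_⟩
    refine (hcount ∅ _ (Finset.empty_subset _) (by simp)).trans ?_
    simpa using hle
  push Not at hle
  set F := (Set.toFinite (front G r)).toFinset with hF
  have hFcard : F.card ≤ k := by
    have h1 := hk r
    rw [(Set.toFinite (front G r)).encard_eq_coe_toFinset_card] at h1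
    exact_mod_cast h1
  -- There are at most `k²` pairs and more than `k²(2k-1)` demands, so some pair is demanded at
  -- least `2k` times.
  obtain ⟨⟨p, q⟩, hpq, hfib⟩ := Finset.exists_lt_card_fiber_of_mul_lt_card_of_maps_to
    (s := D) (t := F ×ˢ F) (f := fun δ => (s δ, t δ)) (n := 2 * k - 1)
    (by
      intro δ hδ
      simp only [Finset.mem_product, hF, Set.Finite.mem_toFinset]
      exact hD δ hδ)
    (by
      refine lt_of_le_of_lt ?_ hle
      rw [Finset.card_product, loadBound, sq]
      gcongr)
  simp only [Finset.mem_product, hF, Set.Finite.mem_toFinset] at hpq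
  set D₀ := D.filter (fun δ => (s δ, t δ) = (p, q)) with hD₀
  have hD₀D : D₀ ⊆ D := Finset.filter_subset _ _
  have hst : ∀ δ ∈ D₀, s δ = p ∧ t δ = q := by
    intro δ hδ
    have := (Finset.mem_filter.1 hδ).2
    simpa using this
  -- Demands from a vertex to itself use no child at all, which already saves `2k` of them.
  by_cases hne : p = q
  · subst hne
    obtain ⟨dip, hdip⟩ := hroute {r}
    refine ⟨{r}, isPrefix_singleton r, hasLayout_singleton r,
      fun δ => if δ ∈ D₀ then ∅ else dip δ, ?_, fun w _ => ?_⟩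
    · intro δ hδ
      by_cases h0 : δ ∈ D₀
      · simp only [if_pos h0, (hst δ h0).1, (hst δ h0).2]
        exact route_refl _ _
      · simp only [if_neg h0]
        exact hdip δ hδ
    · refine (hcount D₀ _ hD₀D ?_).trans (by omega)
      intro δ hδ
      simp [hδ]
  · have hcut := isCutPrefix_cutPrefix hpq.1 hpq.2
    obtain ⟨dip, hdip⟩ := hroute (cutPrefix G r p q)
    obtain ⟨d₁, d₂, hd₁, hd₂, hd⟩ := exists_two_routes (E := cutPrefix G r p q) hpq.1 hpq.2
      (by
        intro w hw
        by_contra hc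
        exact hw.2.1 ⟨hw.1, Or.inr hc⟩)
    -- Exactly `k` of the demands for `(p, q)` take the first route and the others, again at least
    -- `k`, take the second. A child lies on at most one of the two, so it is spared at least `k`
    -- demands.
    obtain ⟨D₁, hD₁, hD₁c⟩ := Finset.exists_subset_card_eq (show k ≤ D₀.card by omega)
    refine ⟨cutPrefix G r p q, hcut.toIsPrefix, ?_,
      fun δ => if δ ∈ D₁ then d₁ else if δ ∈ D₀ then d₂ else dip δ, ?_, fun w _ => ?_⟩
    · by_cases hr : cutPrefix G r p q = {r}
      · rw [hr]
        exact hasLayout_singleton r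
      · exact hcut.hasLayout hk hr
    · intro δ hδ
      by_cases h1 : δ ∈ D₁
      · simp only [if_pos h1, (hst δ (hD₁ h1)).1, (hst δ (hD₁ h1)).2]
        exact hd₁
      · by_cases h0 : δ ∈ D₀
        · simp only [if_neg h1, if_pos h0, (hst δ h0).1, (hst δ h0).2]
          exact hd₂
        · simp only [if_neg h1, if_neg h0]
          exact hdip δ hδ
    · by_cases hw : w ∈ d₁
      · refine (hcount (D₀ \ D₁) _ (Finset.sdiff_subset.trans hD₀D) ?_).trans ?_
        · intro δ hδ
          rw [Finset.mem_sdiff] at hδ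
          simp only [if_neg hδ.2, if_pos hδ.1]
          exact hd w hw
        · rw [Finset.card_sdiff_of_subset hD₁]
          omega
      · refine (hcount D₁ _ (hD₁.trans hD₀D) ?_).trans (by omega)
        intro δ hδ
        simp only [if_pos hδ]
        exact hw

end Contraction

/-! ### Recursive construction of the parts and the guiding sets -/

section Guides

variable {V : Type u} [LinearOrder V] {G : SimpleGraph V} {k : ℕ} {par : V → V}
  {R R' E : Set V} {D : Finset (V × V)} {s t : V × V → V} {Q : V × V → Set V} {r u v w y z : V}

theorem HasLayout.congr {V : Type u} {n : ℕ∞} {adj adj' : V → V → Prop} {A X Y : Set V}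
    (h : HasLayout n adj A X Y) (hadj : ∀ u ∈ A, ∀ v ∈ A, adj' u v → adj u v) :
    HasLayout n adj' A X Y := by
  obtain ⟨ι, i1, i2, bag, h1, h2, h3, h4, h5⟩ := h
  exact ⟨ι, i1, i2, bag, h1, h2, h3, fun u hu v hv huv => h4 u hu v hv (hadj u hu v hv huv), h5⟩

/-- The vertices of `cone G z` that are in no smaller cone with root in `R`. -/
def part (G : SimpleGraph V) (R : Set V) (z : V) : Set V :=
  {v | v ∈ cone G z ∧ ∀ z' ∈ R, z' ∈ cone G z → v ∈ cone G z' → z' = z}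

/-- Adjacency after turning the fronts of the members of `R` into cliques. -/
def frontAdj (G : SimpleGraph V) (R : Set V) (u v : V) : Prop :=
  G.Adj u v ∨ ∃ y ∈ R, u ∈ front G y ∧ v ∈ front G y

theorem part_congr (h : ∀ x ∈ cone G z, x ∈ R ↔ x ∈ R') : part G R z = part G R' z := by
  ext v
  refine and_congr_right fun _ => forall_congr' fun x => ?_
  exact ⟨fun H h1 h2 => H ((h x h2).2 h1) h2, fun H h1 h2 => H ((h x h2).1 h1) h2⟩

theorem hasLayout_part_congr {n : ℕ∞} (h : ∀ x ∈ cone G z, x ∈ R ↔ x ∈ R')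
    (hR : HasLayout n (frontAdj G R) (part G R z) ∅ ∅) :
    HasLayout n (frontAdj G R') (part G R' z) ∅ ∅ := by
  rw [← part_congr h]
  refine hR.congr ?_
  rintro u hu v hv (huv | ⟨y, hy, h1, h2⟩)
  · exact Or.inl huv
  · exact Or.inr ⟨y, (h y (mem_cone_trans (mem_cone_of_mem_front h1) hu.1)).2 hy, h1, h2⟩

/-- A set `R` of roots of parts below `r`, and a connected set `Q (y, s)` guiding from `par y` to
`s` for each `y ∈ R` and `s ∈ front G y`, such that few of these sets, and of the sets `Q δ` for
the further demands `δ ∈ D`, meet the cone of any given member of `R`. -/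
structure IsGuide (G : SimpleGraph V) (k : ℕ) (par : V → V) (r : V) (D : Finset (V × V))
    (s t : V × V → V) (R : Set V) (Q : V × V → Set V) : Prop where
  subset : R ⊆ cone G r
  root_mem : r ∈ R
  layout : ∀ z ∈ R, HasLayout (2 * k + 2 : ℕ) (frontAdj G R) (part G R z) ∅ ∅
  demand : ∀ δ ∈ D, ConnSet G (Q δ) ∧ s δ ∈ Q δ ∧ t δ ∈ Q δ ∧ Q δ ⊆ cone G r ∪ {s δ, t δ}
  own : ∀ y ∈ R, ∀ x ∈ front G y, ConnSet G (Q (y, x)) ∧ x ∈ Q (y, x) ∧ par y ∈ Q (y, x) ∧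
    Q (y, x) ⊆ cone G y ∪ {x, par y}
  load : ∀ z ∈ R, {δ | (δ ∈ D ∨ (δ.1 ∈ R ∧ δ.1 ≠ z ∧ z ∈ cone G δ.1 ∧ δ.2 ∈ front G δ.1)) ∧
    (Q δ ∩ cone G z).Nonempty}.ncard ≤ loadBound k

/-- Induction from the largest `r` downwards. The received demands and the at most `k` own ones are
routed by `exists_step`, after which each child again receives at most `loadBound k`. The first
coordinates of received demands lie outside `cone G r`, so demands created inside never clash with
them. -/
theorem exists_isGuide [Finite V] (hk : ∀ v, (front G v).encard ≤ k)
    (hpar : ∀ y, (front G y).Nonempty → par y ∈ front G y) (r : V) :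
    ∀ (D : Finset (V × V)) (s t : V × V → V), (∀ δ ∈ D, s δ ∈ front G r ∧ t δ ∈ front G r) →
      (∀ δ ∈ D, δ.1 ∉ cone G r) → D.card ≤ loadBound k → ∃ R Q, IsGuide G k par r D s t R Q := by
  classical
  induction r using (Finite.wellFounded_of_trans_of_irrefl (fun x y : V => y < x)).induction with
  | _ r ih =>
  intro D s t hst hD hcard
  have : Nonempty V := ⟨r⟩
  set O : Finset (V × V) := (Set.toFinite (front G r)).toFinset.image (fun x => (r, x)) with hO
  have mem_O : ∀ δ, δ ∈ O ↔ δ.1 = r ∧ δ.2 ∈ front G r := by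
    rintro ⟨a, b⟩
    simp only [hO, Finset.mem_image, Set.Finite.mem_toFinset, Prod.mk.injEq]
    constructor
    · rintro ⟨x, hx, rfl, rfl⟩
      exact ⟨rfl, hx⟩
    · rintro ⟨h1, h2⟩
      exact ⟨b, h2, h1.symm, rfl⟩
  have hOD : ∀ δ ∈ O, δ ∉ D := fun δ hδ hδD =>
    hD δ hδD (by rw [((mem_O δ).1 hδ).1]; exact self_mem_cone r)
  have hOcard : O.card ≤ k := by
    refine Finset.card_image_le.trans ?_
    have h1 := hk r
    rw [(Set.toFinite (front G r)).encard_eq_coe_toFinset_card] at h1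
    exact_mod_cast h1
  set s' : V × V → V := fun δ => if δ ∈ D then s δ else δ.2 with hs'
  set t' : V × V → V := fun δ => if δ ∈ D then t δ else par r with ht'
  have hst' : ∀ δ ∈ D ∪ O, s' δ ∈ front G r ∧ t' δ ∈ front G r := by
    intro δ hδ
    by_cases h : δ ∈ D
    · simpa only [hs', ht', if_pos h] using hst δ h
    · have := (mem_O δ).1 ((Finset.mem_union.1 hδ).resolve_left h)
      simpa only [hs', ht', if_neg h] using ⟨this.2, hpar r ⟨_, this.2⟩⟩
  obtain ⟨E, hE, hlay, dip, hroute, hload⟩ := exists_step hk r (D ∪ O) s' t' hst'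
    ((Finset.card_union_le _ _).trans (by omega))
  choose! f g B hfg hBE hsB htB hconn using hroute
  have hlt : ∀ w, IsChild G r E w → r < w := by
    intro w hw
    refine lt_of_le_of_ne (le_of_mem_cone hw.1) ?_
    rintro rfl
    exact hw.2.1 hE.root_mem
  have hsub : ∀ w, IsChild G r E w → ∃ R Q, IsGuide G k par w
      ((D ∪ O).filter fun δ => w ∈ dip δ) (fun δ => f δ w) (fun δ => g δ w) R Q := by
    intro w hw
    refine ih w (hlt w hw) _ _ _ ?_ ?_ ?_
    · intro δ hδ
      rw [Finset.mem_filter] at hδ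
      have := hfg δ hδ.1 w hδ.2
      exact ⟨this.2.1, this.2.2.1⟩
    · intro δ hδ hc
      rw [Finset.mem_filter, Finset.mem_union] at hδ
      rcases hδ.1 with h | h
      · exact hD δ h (cone_subset hw.1 hc)
      · rw [((mem_O δ).1 h).1] at hc
        exact hE.notMem_cone_of_isChild hw hE.root_mem hc
    · refine le_of_eq_of_le ?_ (hload w hw)
      rw [← Set.ncard_coe_finset]
      simp
  choose! Rc Qc hguide using hsub
  set child : V → V := contract G r E with hchild
  set R : Set V := {z | z = r ∨ ∃ w, IsChild G r E w ∧ z ∈ Rc w} with hR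
  -- A demand handled at `r` follows its route, and the gap at each child `w` is filled by the set
  -- built there for the demand from `f δ w` to `g δ w`. Every other demand is created inside a
  -- single child.
  set Q : V × V → Set V := fun δ =>
    if δ ∈ D ∪ O then B δ ∪ ⋃ w ∈ dip δ, Qc w δ else Qc (child δ.1) δ with hQ
  have hRcone : R ⊆ cone G r := by
    rintro z (rfl | ⟨w, hw, hz⟩)
    · exact self_mem_cone z
    · exact cone_subset hw.1 ((hguide w hw).subset hz)
  have hRchild : ∀ w, IsChild G r E w → ∀ z ∈ cone G w, z ∈ R ↔ z ∈ Rc w := by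
    intro w hw z hz
    refine ⟨?_, fun h => Or.inr ⟨w, hw, h⟩⟩
    rintro (rfl | ⟨w', hw', hz'⟩)
    · exact absurd hz (hE.notMem_cone_of_isChild hw hE.root_mem)
    · rwa [hw.eq_of_mem hw' hz ((hguide w' hw').subset hz')]
  have hpart : part G R r = E := by
    ext v
    constructor
    · rintro ⟨hv, h⟩
      by_contra hvE
      obtain ⟨w, hw, hvw⟩ := exists_isChild hv hvE
      have := h w (Or.inr ⟨w, hw, (hguide w hw).root_mem⟩) hw.1 hvw
      exact hw.2.1 (this ▸ hE.root_mem)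
    · intro hv
      refine ⟨hE.subset hv, ?_⟩
      rintro z (rfl | ⟨w, hw, hz⟩) - hvz
      · rfl
      · exact absurd (mem_cone_trans hvz ((hguide w hw).subset hz))
          (hE.notMem_cone_of_isChild hw hv)
  have hQD : ∀ δ ∈ D ∪ O, ConnSet G (Q δ) ∧ s' δ ∈ Q δ ∧ t' δ ∈ Q δ ∧
      Q δ ⊆ cone G r ∪ {s' δ, t' δ} := by
    intro δ hδ
    have hdip : ∀ w ∈ dip δ, δ ∈ (D ∪ O).filter fun δ => w ∈ dip δ := fun w hw =>
      Finset.mem_filter.2 ⟨hδ, hw⟩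
    simp only [hQ, if_pos hδ]
    refine ⟨hconn δ hδ (fun w => Qc w δ) ?_, Or.inl (hsB δ hδ), Or.inl (htB δ hδ), ?_⟩
    · intro w hw
      obtain ⟨h1, h2, h3, -⟩ := (hguide w (hfg δ hδ w hw).1).demand δ (hdip w hw)
      exact ⟨h1, h2, h3⟩
    · have hB : B δ ⊆ cone G r ∪ {s' δ, t' δ} :=
        (hBE δ hδ).trans (union_subset_union_left _ hE.subset)
      refine union_subset hB (iUnion₂_subset fun w hw => ?_)
      obtain ⟨hwc, -, -, h4, h5⟩ := hfg δ hδ w hw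
      refine ((hguide w hwc).demand δ (hdip w hw)).2.2.2.trans (union_subset ?_ ?_)
      · exact (cone_subset hwc.1).trans subset_union_left
      · rintro x (rfl | rfl)
        · exact hB h4
        · exact hB h5
  have hQchild : ∀ w, IsChild G r E w → ∀ δ : V × V, δ.1 ∈ cone G w → Q δ = Qc w δ := by
    intro w hw δ hδ
    have hn : δ ∉ D ∪ O := by
      rw [Finset.mem_union]
      rintro (h | h)
      · exact hD δ h (cone_subset hw.1 hδ)
      · rw [((mem_O δ).1 h).1] at hδ
        exact hE.notMem_cone_of_isChild hw hE.root_mem hδ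
    simp only [hQ, if_neg hn, hchild, contract_of_mem hw hδ]
  refine ⟨R, Q, hRcone, Or.inl rfl, ?_, ?_, ?_, ?_⟩
  · rintro z (rfl | ⟨w, hw, hz⟩)
    · rw [hpart]
      refine hlay.congr ?_
      rintro u hu v hv (huv | ⟨y, hy, h1, h2⟩)
      · exact Or.inl huv
      rcases hy with rfl | ⟨w, hw, hy⟩
      · exact absurd (hE.subset hu) h1.1
      · have hyw := (hguide w hw).subset hy
        exact Or.inr ⟨w, hw,
          (mem_cone_or_front hyw h1).resolve_left (hE.notMem_cone_of_isChild hw hu),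
          (mem_cone_or_front hyw h2).resolve_left (hE.notMem_cone_of_isChild hw hv)⟩
    · refine hasLayout_part_congr (fun x hx => ?_) ((hguide w hw).layout z hz)
      exact (hRchild w hw x (mem_cone_trans hx ((hguide w hw).subset hz))).symm
  · intro δ hδ
    have := hQD δ (Finset.mem_union_left _ hδ)
    simpa only [hs', ht', if_pos hδ] using this
  · rintro y (rfl | ⟨w, hw, hy⟩) x hx
    · have hδ : (y, x) ∈ O := (mem_O _).2 ⟨rfl, hx⟩
      have := hQD (y, x) (Finset.mem_union_right _ hδ)
      simpa only [hs', ht', if_neg (hOD _ hδ)] using this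
    · rw [hQchild w hw (y, x) ((hguide w hw).subset hy)]
      exact (hguide w hw).own y hy x hx
  · rintro z (rfl | ⟨w, hw, hz⟩)
    -- No member of `R` other than `r` lies above `r`, so only the received demands count.
    · refine le_trans (Set.ncard_le_ncard ?_ (Finset.finite_toSet D))
        (by rwa [Set.ncard_coe_finset])
      rintro δ ⟨h | ⟨h1, h2, h3, -⟩, -⟩
      · exact h
      · exact absurd (eq_of_mem_cone_of_mem_cone (hRcone h1) h3) h2
    · refine le_trans (Set.ncard_le_ncard ?_ (Set.toFinite _)) ((hguide w hw).load z hz)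
      have hzw := (hguide w hw).subset hz
      -- `B δ` avoids `cone G w`, so a demand reaching `cone G z` must have been passed on to the
      -- child `w`.
      have key : ∀ δ ∈ D ∪ O, (Q δ ∩ cone G z).Nonempty →
          w ∈ dip δ ∧ (Qc w δ ∩ cone G z).Nonempty := by
        rintro δ hδ ⟨x, hx, hxz⟩
        have hxw := mem_cone_trans hxz hzw
        have hB : x ∉ B δ := by
          intro hxB
          rcases hBE δ hδ hxB with h | h | h
          · exact hE.notMem_cone_of_isChild hw h hxw
          · rw [h] at hxw
            exact (hst' δ hδ).1.1 (cone_subset hw.1 hxw)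
          · rw [mem_singleton_iff.1 h] at hxw
            exact (hst' δ hδ).2.1 (cone_subset hw.1 hxw)
        simp only [hQ, if_pos hδ] at hx
        rcases hx with hx | hx
        · exact absurd hx hB
        obtain ⟨w', hw', hx⟩ := mem_iUnion₂.1 hx
        obtain ⟨hwc, -, -, h4, h5⟩ := hfg δ hδ w' hw'
        rcases ((hguide w' hwc).demand δ (Finset.mem_filter.2 ⟨hδ, hw'⟩)).2.2.2 hx with h | h | h
        · have := hwc.eq_of_mem hw h hxw
          subst this
          exact ⟨hw', x, hx, hxz⟩
        · exact absurd (h ▸ h4) hB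
        · exact absurd (mem_singleton_iff.1 h ▸ h5) hB
      rintro δ ⟨hδ, hne⟩
      have hmem : δ ∈ D ∪ O → (δ ∈ (D ∪ O).filter fun δ => w ∈ dip δ) ∧
          (Qc w δ ∩ cone G z).Nonempty := fun h =>
        ⟨Finset.mem_filter.2 ⟨h, (key δ h hne).1⟩, (key δ h hne).2⟩
      rcases hδ with h | ⟨h1, h2, h3, h4⟩
      · have := hmem (Finset.mem_union_left _ h)
        exact ⟨Or.inl this.1, this.2⟩
      · rcases h1 with h1 | ⟨w', hw', h1⟩
        · have := hmem (Finset.mem_union_right _ ((mem_O δ).2 ⟨h1, h1 ▸ h4⟩))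
          exact ⟨Or.inl this.1, this.2⟩
        · have h1w := (hguide w' hw').subset h1
          have := hw'.eq_of_mem hw (mem_cone_trans h3 h1w) hzw
          subst this
          rw [hQchild w' hw' δ h1w] at hne
          exact ⟨Or.inr ⟨h1, h2, h3, h4⟩, hne⟩

end Guides

/-! ### Guiding trees and their coloring -/

section Global

variable {V : Type u} [LinearOrder V] {G : SimpleGraph V} {k : ℕ} {par : V → V}
  {R : Set V} {Q : V × V → Set V} {r u v w x y z : V}

theorem exists_mem_front (h : z ∈ cone G y) (hne : z ≠ y) : ∃ x ∈ front G z, x ∈ cone G y := by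
  obtain ⟨x, hxz, hxy, hx | ⟨w, hw, hwx⟩⟩ := JoinedIn.exists_first (cone G z)ᶜ
    (connSet_cone y z h y (self_mem_cone y))
    (fun hc => hc.right_mem.2 fun hy => hne (eq_of_mem_cone_of_mem_cone h hy))
  · exact absurd (hx ▸ self_mem_cone z) hxz
  · exact ⟨x, ⟨hxz, w, not_not.1 hw.right_mem.2, hwx⟩, hxy⟩

theorem exists_top [Finite V] (v : V) : ∃ r, front G r = ∅ ∧ v ∈ cone G r := by
  obtain ⟨r, hvr, hmin⟩ := (Set.toFinite {r | v ∈ cone G r}).exists_minimalFor id _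
    ⟨v, self_mem_cone v⟩
  refine ⟨r, eq_empty_of_forall_notMem fun x hx => ?_, hvr⟩
  have hlt := front_lt hx
  exact absurd (hmin (mem_cone_trans hvr (mem_cone_of_mem_front hx)) hlt.le) (not_le.2 hlt)

theorem top_unique (h : front G r = ∅) (h' : front G w = ∅) (hv : v ∈ cone G r)
    (hv' : v ∈ cone G w) : r = w := by
  by_contra hne
  rcases mem_cone_or_mem_cone hv hv' with hc | hc
  · obtain ⟨x, hx, -⟩ := exists_mem_front hc (Ne.symm hne)
    simp [h'] at hx
  · obtain ⟨x, hx, -⟩ := exists_mem_front hc hne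
    simp [h] at hx

/-- A set of roots of parts that cover all vertices, with guiding sets. -/
structure IsGlobalGuide (G : SimpleGraph V) (k : ℕ) (par : V → V) (R : Set V)
    (Q : V × V → Set V) : Prop where
  cover : ∀ v, ∃ z ∈ R, v ∈ cone G z
  layout : ∀ z ∈ R, HasLayout (2 * k + 2 : ℕ) (frontAdj G R) (part G R z) ∅ ∅
  own : ∀ y ∈ R, ∀ x ∈ front G y, ConnSet G (Q (y, x)) ∧ x ∈ Q (y, x) ∧ par y ∈ Q (y, x) ∧
    Q (y, x) ⊆ cone G y ∪ {x, par y}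
  load : ∀ z ∈ R, {δ | (δ.1 ∈ R ∧ δ.1 ≠ z ∧ z ∈ cone G δ.1 ∧ δ.2 ∈ front G δ.1) ∧
    (Q δ ∩ cone G z).Nonempty}.ncard ≤ loadBound k

/-- The vertices with empty front have pairwise disjoint cones covering `V`. The recursion starts at
each of them with no demands and the results are combined. -/
theorem exists_isGlobalGuide [Finite V] (hk : ∀ v, (front G v).encard ≤ k)
    (hpar : ∀ y, (front G y).Nonempty → par y ∈ front G y) :
    ∃ R Q, IsGlobalGuide G k par R Q := by
  choose top htop hcone using exists_top (G := G)
  choose Rc Qc hg using fun r => exists_isGuide hk hpar r ∅ (fun _ => r) (fun _ => r)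
    (by simp) (by simp) (by simp)
  have hR : ∀ r, front G r = ∅ → ∀ z ∈ cone G r, z ∈ {z | z ∈ Rc (top z)} ↔ z ∈ Rc r := by
    intro r hr z hz
    rw [Set.mem_ofPred_eq, top_unique (htop z) hr (hcone z) hz]
  have hQ : ∀ y z, z ∈ cone G y → top y = top z := fun y z h =>
    top_unique (htop y) (htop z) (mem_cone_trans h (hcone y)) (hcone z)
  refine ⟨{z | z ∈ Rc (top z)}, fun δ => Qc (top δ.1) δ, ?_, ?_, ?_, ?_⟩
  · intro v
    exact ⟨top v, (hR _ (htop v) _ (self_mem_cone _)).2 (hg _).root_mem, hcone v⟩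
  · intro z hz
    exact hasLayout_part_congr
      (fun x hx => (hR _ (htop z) x (mem_cone_trans hx (hcone z))).symm) ((hg _).layout z hz)
  · intro y hy x hx
    exact (hg _).own y hy x hx
  · intro z hz
    refine le_trans (Set.ncard_le_ncard ?_ (Set.toFinite _)) ((hg _).load z hz)
    rintro δ ⟨⟨h1, h2, h3, h4⟩, hne⟩
    rw [Set.mem_ofPred_eq, hQ _ _ h3] at h1
    rw [hQ _ _ h3] at hne
    exact ⟨Or.inr ⟨h1, h2, h3, h4⟩, hne⟩

theorem part_unique (hz : z ∈ R) (hw : w ∈ R) (hvz : v ∈ part G R z) (hvw : v ∈ part G R w) :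
    z = w := by
  rcases mem_cone_or_mem_cone hvz.1 hvw.1 with h | h
  · exact (hvz.2 w hw h hvw.1).symm
  · exact hvw.2 z hz h hvz.1

theorem exists_mem_part [Finite V] (h : ∀ v, ∃ z ∈ R, v ∈ cone G z) (v : V) :
    ∃ z ∈ R, v ∈ part G R z := by
  obtain ⟨z, ⟨hzR, hvz⟩, hmax⟩ := (Set.toFinite {z | z ∈ R ∧ v ∈ cone G z}).exists_maximalFor id _
    (h v)
  refine ⟨z, hzR, hvz, fun w hw hwz hvw => ?_⟩
  have hle := le_of_mem_cone hwz
  exact le_antisymm (hmax ⟨hw, hvw⟩ hle) hle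

theorem mem_part_or_front (hv : v ∈ part G R z) (hx : x ∈ front G v) :
    x ∈ part G R z ∨ x ∈ front G z := by
  refine (mem_cone_or_front hv.1 hx).imp_left fun h => ⟨h, fun w hw hwz hxw => ?_⟩
  exact hv.2 w hw hwz (mem_cone_trans (mem_cone_of_mem_front hx) hxw)

/-- The tree that guides to `v`. -/
def guideSet (G : SimpleGraph V) (R : Set V) (Q : V × V → Set V) (v : V) : Set V :=
  {v} ∪ {x | ∃ y ∈ R, v ∈ front G y ∧ x ∈ Q (y, v)}

theorem IsGlobalGuide.connSet_guideSet (h : IsGlobalGuide G k par R Q) (v : V) :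
    ConnSet G (guideSet G R Q v) := by
  refine connSet_of_joined v ?_
  rintro x (hx | ⟨y, hy, hv, hx⟩)
  · rw [mem_singleton_iff.1 hx]
    exact JoinedIn.refl (Or.inl rfl)
  · obtain ⟨h1, h2, -⟩ := h.own y hy v hv
    exact (h1 v h2 x hx).mono fun w hw => Or.inr ⟨y, hy, hv, hw⟩

/-- Here `par y` has to be the largest vertex of the front: then it is `v` itself or lies below `v`.
-/
theorem IsGlobalGuide.guideSet_subset (h : IsGlobalGuide G k par R Q)
    (hpar : ∀ y, ∀ x ∈ front G y, par y ∈ front G y ∧ x ≤ par y) (v : V) :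
    guideSet G R Q v ⊆ cone G v := by
  rintro x (hx | ⟨y, hy, hv, hx⟩)
  · rw [mem_singleton_iff.1 hx]
    exact self_mem_cone v
  · rcases (h.own y hy v hv).2.2.2 hx with hx | hx | hx
    · exact mem_cone_trans hx (mem_cone_of_mem_front hv)
    · rw [hx]
      exact self_mem_cone v
    · obtain ⟨h1, h2⟩ := hpar y v hv
      rw [mem_singleton_iff.1 hx]
      rcases h2.eq_or_lt with h2 | h2
      · rw [← h2]
        exact self_mem_cone v
      · exact mem_cone_of_mem_front (mem_front_of_mem_front hv h1 h2)

/-- A conflict comes from some `Q (y, u)` meeting `cone G v`. If it meets it in `par y`, or if `y`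
is in `cone G v`, then `u ∈ front G v`. Otherwise `y` is above `v`: either `y` is the root `z` of
the part of `v`, and `u ∈ front G z`, or `y` is strictly above `z`, and the load of `z` counts the
demand. -/
theorem IsGlobalGuide.ncard_conflicts_le [Finite V] (hk : ∀ v, (front G v).encard ≤ k)
    (h : IsGlobalGuide G k par R Q)
    (hpar : ∀ y, ∀ x ∈ front G y, par y ∈ front G y ∧ x ≤ par y) (v : V) :
    {u | u < v ∧ ¬ Disjoint (guideSet G R Q u) (guideSet G R Q v)}.ncard ≤
      k + k + loadBound k := by
  obtain ⟨z, hz, hvz⟩ := exists_mem_part h.cover v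
  have hk' : ∀ v, (front G v).ncard ≤ k := by
    intro v
    have := hk v
    rw [← (Set.toFinite (front G v)).cast_ncard_eq] at this
    exact_mod_cast this
  set S := {δ : V × V | (δ.1 ∈ R ∧ δ.1 ≠ z ∧ z ∈ cone G δ.1 ∧ δ.2 ∈ front G δ.1) ∧
    (Q δ ∩ cone G z).Nonempty} with hS
  have hsub : {u | u < v ∧ ¬ Disjoint (guideSet G R Q u) (guideSet G R Q v)} ⊆
      front G v ∪ front G z ∪ Prod.snd '' S := by
    rintro u ⟨huv, hd⟩
    obtain ⟨x, hxu, hxv⟩ := not_disjoint_iff.1 hd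
    replace hxv := h.guideSet_subset hpar v hxv
    have hux : u ≠ x := (huv.trans_le (le_of_mem_cone hxv)).ne
    rcases hxu with hxu | ⟨y, hy, huy, hxu⟩
    · exact absurd hxu.symm hux
    rcases (h.own y hy u huy).2.2.2 hxu with hx | hx | hx
    · rcases mem_cone_or_mem_cone hxv hx with hc | hc
      · exact Or.inl (Or.inl (mem_front_of_lt hc huy huv))
      · by_cases hyz : y = z
        · subst hyz
          exact Or.inl (Or.inr huy)
        · refine Or.inr ⟨(y, u), ⟨⟨hy, hyz, ?_, huy⟩, x, hxu, mem_cone_trans hxv hvz.1⟩, rfl⟩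
          exact (mem_cone_or_mem_cone hvz.1 hc).resolve_left fun hyz' =>
            hyz (hvz.2 y hy hyz' hc)
    · exact absurd hx.symm hux
    · rw [mem_singleton_iff] at hx
      refine Or.inl (Or.inl (mem_front_of_lt hxv ?_ huv))
      have hux' : u < x := huv.trans_le (le_of_mem_cone hxv)
      rw [hx] at hux' ⊢
      exact mem_front_of_mem_front huy (hpar y u huy).1 hux'
  calc _ ≤ (front G v ∪ front G z ∪ Prod.snd '' S).ncard :=
        Set.ncard_le_ncard hsub (Set.toFinite _)
    _ ≤ (front G v).ncard + (front G z).ncard + S.ncard :=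
        (Set.ncard_union_le _ _).trans (add_le_add (Set.ncard_union_le _ _)
          (Set.ncard_image_le (Set.toFinite _)))
    _ ≤ _ := add_le_add (add_le_add (hk' v) (hk' z)) (h.load z hz)

theorem exists_greedy_coloring {V : Type*} [LinearOrder V] [Finite V] {n : ℕ}
    (conflict : V → V → Prop) (h : ∀ v, {u | u < v ∧ conflict u v}.ncard < n) :
    ∃ c : V → Fin n, ∀ u v, u < v → conflict u v → c u ≠ c v := by
  have wf : WellFounded (fun a b : V => a < b) := wellFounded_lt
  have step : ∀ (v : V) (rec : ∀ u, u < v → Fin n),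
      ∃ a, ∀ u (hu : u < v), conflict u v → rec u hu ≠ a := by
    intro v rec
    by_contra! hc
    choose f hf hf' hfa using hc
    have hinj : Function.Injective (fun a => (⟨f a, hf a, hf' a⟩ :
        {u | u < v ∧ conflict u v})) := by
      intro a b hab
      simp only [Subtype.mk.injEq] at hab
      rw [← hfa a, ← hfa b]
      congr
    have := Nat.card_le_card_of_injective _ hinj
    rw [Nat.card_coe_set_eq, Nat.card_fin] at this
    exact absurd this (not_le.2 (h v))
  choose F hF using step
  refine ⟨wf.fix F, fun u v huv hc => ?_⟩
  rw [wf.fix_eq F v]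
  exact hF v (fun u _ => wf.fix F u) u huv hc

theorem exists_inTree {V : Type*} {G : SimpleGraph V} {A : Set V} {v : V} (hA : ConnSet G A)
    (hv : v ∈ A) : ∃ s : InTree G, s.tree.verts = A ∧ s.root = v := by
  have hconn : (G.induce A).Connected := by
    have : Nonempty A := ⟨⟨v, hv⟩⟩
    refine ⟨fun a b => ?_⟩
    obtain ⟨p, hp⟩ := hA a a.2 b b.2
    exact ⟨p.induce A hp⟩
  obtain ⟨T, hT, hTree⟩ := hconn.exists_isTree_le
  refine ⟨⟨⟨A, fun a b => ∃ ha hb, T.Adj ⟨a, ha⟩ ⟨b, hb⟩, ?_, ?_, ?_⟩, ?_, v, hv⟩, rfl, rfl⟩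
  · rintro a b ⟨ha, hb, hab⟩
    exact hT hab
  · rintro a b ⟨ha, hb, hab⟩
    exact ha
  · exact ⟨fun a b ⟨ha, hb, hab⟩ => ⟨hb, ha, hab.symm⟩⟩
  · convert hTree using 1
    ext a b
    exact ⟨fun ⟨_, _, h⟩ => h, fun h => ⟨a.2, b.2, h⟩⟩

theorem HasLayout.pathwidth_le {V : Type u} {n : ℕ∞} {adj : V → V → Prop} {A X Y : Set V}
    (h : HasLayout n adj A X Y) (H : SimpleGraph A) (hH : ∀ u v : A, H.Adj u v → adj u v) :
    pathwidth H ≤ n - 1 := by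
  obtain ⟨ι, i1, i2, bag, -, h2, h3, h4, h5, -⟩ := h
  have := Fintype.ofFinite ι
  let e := Fintype.orderIsoFinOfCardEq ι rfl
  let p : PathDecomposition H :=
    { length := Fintype.card ι
      bag := fun i => Subtype.val ⁻¹' bag (e i)
      vertex_mem := by
        intro v
        obtain ⟨i, hi⟩ := h3 v v.2
        exact ⟨e.symm i, by simpa using hi⟩
      edge_mem := by
        intro u v huv
        obtain ⟨i, hi, hi'⟩ := h4 u u.2 v v.2 (hH u v huv)
        exact ⟨e.symm i, by simpa using hi, by simpa using hi'⟩
      consecutive := fun v i j l hij hjl hi hl =>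
        h5 v (e i) (e j) (e l) (e.monotone hij) (e.monotone hjl) hi hl }
  refine (iInf_le _ p).trans (iSup_le fun i => tsub_le_tsub_right ?_ 1)
  rw [← Subtype.val_injective.encard_image]
  exact (encard_le_encard (image_preimage_subset _ _)).trans (h2 _)

end Global

/-! ### The new tree decomposition -/

section Assembly

variable {V : Type u} [LinearOrder V] {G : SimpleGraph V} {k : ℕ} {par : V → V}
  {R : Set V} {Q : V × V → Set V} {u v w x y z : V}

/-- The parent of the node of `z` is the node whose part contains `par z`. All other vertices of
`front G z` lie in the front of `par z`, so the parent bag contains the whole front, and it contains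
no vertex of the part of `z`. -/
theorem exists_guided_treeDecomposition [Finite V]
    (hpar : ∀ y, ∀ x ∈ front G y, par y ∈ front G y ∧ x ≤ par y)
    (h : ∀ v, ∃ z ∈ R, v ∈ cone G z) :
    ∃ (t : TreeDecomposition G) (ρ : t.Node → V), (∀ x, ρ x ∈ R) ∧
      (∀ x, t.adhesion x = front G (ρ x)) ∧ ∀ x, t.margin x = part G R (ρ x) := by
  classical
  -- The nodes are numbered because `Node` lives in `Type`, whereas `V` may live in any universe.
  let e : R ≃ Fin (Nat.card R) := Finite.equivFin R
  let ρ : Fin (Nat.card R) → V := fun i => (e.symm i : V)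
  have hρR : ∀ i, ρ i ∈ R := fun i => (e.symm i).2
  have hρ : Function.Injective ρ := Subtype.val_injective.comp e.symm.injective
  have hex : ∀ v, ∃ i, v ∈ part G R (ρ i) := by
    intro v
    obtain ⟨z, hz, hv⟩ := exists_mem_part h v
    refine ⟨e ⟨z, hz⟩, ?_⟩
    change v ∈ part G R (e.symm (e ⟨z, hz⟩) : V)
    rwa [e.symm_apply_apply]
  choose home hhome using hex
  have home_eq : ∀ {v i}, v ∈ part G R (ρ i) → i = home v := fun {v i} hv =>
    hρ (part_unique (hρR _) (hρR _) hv (hhome v))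
  let parent : Fin (Nat.card R) → Option (Fin (Nat.card R)) := fun i =>
    if (front G (ρ i)).Nonempty then some (home (par (ρ i))) else none
  let bag : Fin (Nat.card R) → Set V := fun i => part G R (ρ i) ∪ front G (ρ i)
  have parent_some : ∀ {i j}, parent i = some j → (front G (ρ i)).Nonempty ∧
      j = home (par (ρ i)) := by
    intro i j hij
    by_cases hne : (front G (ρ i)).Nonempty
    · simp only [parent, if_pos hne, Option.some.injEq] at hij
      exact ⟨hne, hij.symm⟩
    · simp [parent, if_neg hne] at hij
  have parent_lt : ∀ {i j}, parent i = some j → ρ j < ρ i := by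
    intro i j hij
    obtain ⟨⟨x, hx⟩, rfl⟩ := parent_some hij
    exact (le_of_mem_cone (hhome _).1).trans_lt (front_lt (hpar _ x hx).1)
  have mem_parent : ∀ i, ∀ x ∈ front G (ρ i), ∃ j, parent i = some j ∧ x ∈ bag j := by
    intro i x hx
    refine ⟨home (par (ρ i)), if_pos ⟨x, hx⟩, ?_⟩
    obtain ⟨h1, h2⟩ := hpar _ x hx
    rcases h2.eq_or_lt with h2 | h2
    · rw [h2]
      exact Or.inl (hhome _)
    · exact mem_part_or_front (hhome _) (mem_front_of_mem_front hx h1 h2)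
  have hwf : WellFounded (fun p c => parent c = some p) :=
    Subrelation.wf (fun {_ _} h => parent_lt h) (InvImage.wf ρ wellFounded_lt)
  let t : TreeDecomposition G :=
    { Node := Fin (Nat.card R)
      finite_node := inferInstance
      parent := parent
      wf := hwf
      bag := bag
      edge_mem := by
        have key : ∀ u v : V, G.Adj u v → u < v → ∃ x, u ∈ bag x ∧ v ∈ bag x :=
          fun u v huv hlt => ⟨home v, mem_part_or_front (hhome v)
            (mem_front_of_adj (self_mem_cone v) huv.symm hlt), Or.inl (hhome v)⟩
        intro u v huv
        rcases lt_or_gt_of_ne huv.ne with hlt | hlt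
        · exact key u v huv hlt
        · obtain ⟨x, h1, h2⟩ := key v u huv.symm hlt
          exact ⟨x, h2, h1⟩
      connected := by
        intro v
        have key : ∀ i (hi : v ∈ bag i), ((SimpleGraph.fromRel
            (fun c p => parent c = some p)).induce {x | v ∈ bag x}).Reachable ⟨i, hi⟩
              ⟨home v, Or.inl (hhome v)⟩ := by
          intro i
          induction i using hwf.induction with
          | _ i ih =>
          intro hi
          rcases id hi with hp | hf
          · obtain rfl := home_eq hp
            exact SimpleGraph.Reachable.refl _
          · obtain ⟨j, hij, hj⟩ := mem_parent i v hf
            refine SimpleGraph.Reachable.trans (SimpleGraph.Adj.reachable ?_) (ih j hij hj)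
            simp only [SimpleGraph.comap_adj, Function.Embedding.subtype_apply,
              SimpleGraph.fromRel_adj]
            exact ⟨fun hc => (parent_lt hij).ne (by rw [hc]), Or.inl hij⟩
        exact (SimpleGraph.connected_iff_exists_forall_reachable _).2
          ⟨⟨home v, Or.inl (hhome v)⟩, fun ⟨i, hi⟩ => (key i hi).symm⟩ }
  have hadh : ∀ x, t.adhesion x = front G (ρ x) := by
    intro i
    ext v
    constructor
    · rintro ⟨hv | hv, j, hij, hvj⟩
      · have hlt := parent_lt hij
        rcases hvj with hvj | hvj
        · rw [home_eq hv, home_eq hvj] at hlt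
          exact absurd hlt (lt_irrefl _)
        · exact absurd ((front_lt hvj).trans hlt) (not_lt.2 (le_of_mem_cone hv.1))
      · exact hv
    · intro hv
      exact ⟨Or.inr hv, mem_parent i v hv⟩
  refine ⟨t, ρ, hρR, hadh, fun x => ?_⟩
  rw [TreeDecomposition.margin, hadh]
  ext v
  constructor
  · rintro ⟨hv | hv, hn⟩
    · exact hv
    · exact absurd hv hn
  · intro hv
    exact ⟨Or.inl hv, fun hf => hf.1 hv.1⟩

theorem exists_treeDecomposition_of_front [Finite V] (hk : ∀ v, (front G v).encard ≤ k) :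
    ∃ t : TreeDecomposition G,
      (∀ x : t.Node, pathwidth (t.marginalGraph x) ≤ ((2 * k + 1 : ℕ) : ℕ∞)) ∧
      ∃ Λ : GuidanceSystem G,
        Λ.Captures t.adhesions ∧ Λ.Colorable (4 * k ^ 3 + 2 * k) := by
  have hpar : ∀ y, ∃ p, ∀ x ∈ front G y, p ∈ front G y ∧ x ≤ p := by
    intro y
    rcases (front G y).eq_empty_or_nonempty with h | h
    · exact ⟨y, by simp [h]⟩
    · obtain ⟨p, hp, hmax⟩ := (Set.toFinite (front G y)).exists_maximalFor id _ h
      refine ⟨p, fun x hx => ⟨hp, ?_⟩⟩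
      rcases le_total x p with hxp | hxp
      · exact hxp
      · exact hmax hx hxp
  choose par hpar using hpar
  obtain ⟨R, Q, hRQ⟩ := exists_isGlobalGuide hk fun y ⟨x, hx⟩ => (hpar y x hx).1
  obtain ⟨t, ρ, hρ, hadh, hmar⟩ := exists_guided_treeDecomposition hpar hRQ.cover
  refine ⟨t, fun x => ?_, ?_⟩
  · have hlay := hRQ.layout (ρ x) (hρ x)
    rw [← hmar] at hlay
    refine (hlay.pathwidth_le _ ?_).trans (le_of_eq ?_)
    · rintro u v (huv | ⟨-, y, hu, hv⟩)
      · exact Or.inl huv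
      · rw [hadh] at hu hv
        exact Or.inr ⟨ρ y, hρ y, hu, hv⟩
    · norm_cast
  -- For `k = 0` no color is available, but all adhesions are empty. Capturing them still takes some
  -- vertex, and `ρ x` serves.
  rcases Nat.eq_zero_or_pos k with rfl | hpos
  · refine ⟨∅, ?_, fun s => s.2.elim, fun s => s.2.elim⟩
    rintro _ ⟨x, rfl⟩
    refine ⟨ρ x, ?_⟩
    have h0 := hk (ρ x)
    rw [Nat.cast_zero, nonpos_iff_eq_zero, encard_eq_zero] at h0
    rw [hadh, h0]
    exact empty_subset _
  choose T hTv hTr using fun v => exists_inTree (hRQ.connSet_guideSet v)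
    (show v ∈ guideSet G R Q v from Or.inl rfl)
  obtain ⟨c, hc⟩ := exists_greedy_coloring (n := 4 * k ^ 3 + 2 * k)
    (fun u v => ¬ Disjoint (guideSet G R Q u) (guideSet G R Q v)) (by
      intro v
      -- There are at most `2k + k²(2k-1)` conflicts, and this is at most `2k + 2k³`, less than the
      -- number of colors as `k > 0`.
      refine (hRQ.ncard_conflicts_le hk hpar v).trans_lt ?_
      have h1 : loadBound k ≤ 2 * k ^ 3 := by
        calc k ^ 2 * (2 * k - 1) ≤ k ^ 2 * (2 * k) := by gcongr; omega
          _ = 2 * k ^ 3 := by ring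
      have h2 : 0 < k ^ 3 := by positivity
      omega)
  refine ⟨range T, ?_, fun s => c s.1.root, ?_⟩
  · rintro _ ⟨x, rfl⟩
    rw [hadh]
    refine ⟨par (ρ x), fun v hv => ⟨T v, ⟨v, rfl⟩, ?_, hTr v⟩⟩
    rw [hTv]
    exact Or.inr ⟨ρ x, hρ x, hv, (hRQ.own (ρ x) (hρ x) v hv).2.2.1⟩
  · rintro ⟨_, u, rfl⟩ ⟨_, v, rfl⟩ hne hcol
    simp only [hTr, hTv] at hcol ⊢
    by_contra hd
    rcases lt_trichotomy u v with hlt | rfl | hlt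
    · exact hc u v hlt hd hcol
    · exact hne rfl
    · exact hc v u hlt (fun h => hd h.symm) hcol.symm

end Assembly

/-! ### From a tree decomposition to a vertex order -/

namespace TreeDecomposition

variable {V : Type*} {G : SimpleGraph V} (t : TreeDecomposition G)

/-- `t.Below x y` means that `y` is reached from `x` by taking parents. -/
def Below (x y : t.Node) : Prop := Relation.ReflTransGen (fun c p => t.parent c = some p) x y

/-- The depth of a node. -/
noncomputable def depth (x : t.Node) : Ordinal.{0} :=
  have : IsWellFounded t.Node (fun p c => t.parent c = some p) := ⟨t.wf⟩
  IsWellFounded.rank (fun p c => t.parent c = some p) x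

variable {t} {x y z : t.Node} {v : V}

theorem depth_lt (h : t.parent x = some y) : t.depth y < t.depth x :=
  have : IsWellFounded t.Node (fun p c => t.parent c = some p) := ⟨t.wf⟩
  IsWellFounded.rank_lt_of_rel (r := fun p c => t.parent c = some p) h

theorem Below.total (hy : t.Below x y) (hz : t.Below x z) : t.Below y z ∨ t.Below z y :=
  Relation.ReflTransGen.total_of_right_unique
    (fun _ _ _ hb hc => Option.some.inj (hb.symm.trans hc)) hy hz

theorem Below.depth_le (h : t.Below x y) : t.depth y ≤ t.depth x := by
  induction h with
  | refl => exact le_rfl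
  | tail _ h ih => exact (depth_lt h).le.trans ih

theorem Below.eq_of_depth_le (h : t.Below x y) (hr : t.depth x ≤ t.depth y) : x = y := by
  rcases h.cases_head with h | ⟨c, hc, h⟩
  · exact h
  · exact absurd (hr.trans (Below.depth_le h)) (not_le.2 (depth_lt hc))

theorem Below.swap (hy : t.Below x y) (hz : t.Below x z) (h : t.depth z ≤ t.depth y) :
    t.Below y z := by
  rcases hy.total hz with h' | h'
  · exact h'
  · rw [h'.eq_of_depth_le h]
    exact Relation.ReflTransGen.refl

/-- Every vertex has a topmost node, and its bags are closed under going up to that node. -/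
theorem exists_topNode (t : TreeDecomposition G) (v : V) :
    ∃ h, v ∈ t.bag h ∧ ∀ x, v ∈ t.bag x →
      t.Below x h ∧ ∀ z, t.Below x z → t.Below z h → v ∈ t.bag z := by
  obtain ⟨⟨x₀, hx₀⟩⟩ := (t.connected v).nonempty
  obtain ⟨h, hh, hmin⟩ := t.wf.has_min {x | v ∈ t.bag x} ⟨x₀, hx₀⟩
  refine ⟨h, hh, fun x hx => ?_⟩
  obtain ⟨p⟩ := (t.connected v).preconnected ⟨x, hx⟩ ⟨h, hh⟩
  have key : ∀ (a b : {x | v ∈ t.bag x}) (p : ((SimpleGraph.fromRel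
      (fun c p : t.Node => t.parent c = some p)).induce {x | v ∈ t.bag x}).Walk a b),
      b.1 = h → t.Below a h ∧ ∀ z, t.Below a z → t.Below z h → v ∈ t.bag z := by
    intro a b p
    induction p with
    | nil =>
      rintro rfl
      refine ⟨Relation.ReflTransGen.refl, fun z h1 h2 => ?_⟩
      rw [← h1.eq_of_depth_le h2.depth_le]
      exact hh
    | @cons a b c hab p ih =>
      intro hc
      obtain ⟨h1, h2⟩ := ih hc
      simp only [SimpleGraph.comap_adj, Function.Embedding.subtype_apply,
        SimpleGraph.fromRel_adj] at hab
      rcases hab.2 with hp | hp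
      · refine ⟨Relation.ReflTransGen.head hp h1, fun z hz hz' => ?_⟩
        rcases hz.cases_head with rfl | ⟨d, hd, hz⟩
        · exact a.2
        · obtain rfl := Option.some.inj (hp.symm.trans hd)
          exact h2 z hz hz'
      · rcases h1.cases_head with hb | ⟨d, hd, h1⟩
        · rw [hb] at hp
          exact absurd hp (hmin a a.2)
        · obtain rfl := Option.some.inj (hp.symm.trans hd)
          exact ⟨h1, fun z hz hz' => h2 z (Relation.ReflTransGen.head hp hz) hz'⟩
  exact key _ _ p rfl

end TreeDecomposition

/-- Adjacent vertices share a node, which is below the topmost nodes of both, so these are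
comparable. By induction all topmost nodes of `cone G v` are below `h v`. A front vertex `u` shares
a node below `h v` with a vertex of the cone, and `h u` is above `h v` by depth, so the bag of `h v`
contains `u`. -/
theorem front_subset_bag {V : Type*} [LinearOrder V] {G : SimpleGraph V}
    (t : TreeDecomposition G) {h : V → t.Node}
    (hh : ∀ v x, v ∈ t.bag x → t.Below x (h v) ∧
      ∀ z, t.Below x z → t.Below z (h v) → v ∈ t.bag z)
    (hle : ∀ u v, u ≤ v → t.depth (h u) ≤ t.depth (h v)) (v : V) :
    front G v ⊆ t.bag (h v) := by
  have hcone : ∀ x ∈ cone G v, t.Below (h x) (h v) := by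
    intro x hx
    refine JoinedIn.induction (P := fun x => t.Below (h x) (h v)) hx Relation.ReflTransGen.refl ?_
    intro a b _ hPa hab hb
    obtain ⟨y, hya, hyb⟩ := t.edge_mem a b hab
    exact (hh b y hyb).1.swap ((hh a y hya).1.trans hPa) (hle v b hb)
  intro u hu
  have hlt := front_lt hu
  obtain ⟨-, x, hx, hxu⟩ := hu
  obtain ⟨y, hyx, hyu⟩ := t.edge_mem x u hxu
  have hyv : t.Below y (h v) := (hh x y hyx).1.trans (hcone x hx)
  exact (hh u y hyu).2 _ hyv (hyv.swap (hh u y hyu).1 (hle u v hlt.le))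

/-- Ties in depth are broken arbitrarily. The bag of `h v` contains `v`, which is not in its own
front; this turns `k + 1` into `k`. -/
theorem exists_linearOrder_front {V : Type*} [Finite V] {G : SimpleGraph V} {k : ℕ}
    (t : TreeDecomposition G) (ht : t.width ≤ k) :
    ∃ _ : LinearOrder V, ∀ v, (front G v).encard ≤ k := by
  choose h hmem hh using t.exists_topNode
  let e := Finite.equivFin V
  let f : V → Lex (Ordinal × Fin (Nat.card V)) := fun v => toLex (t.depth (h v), e v)
  have hf : Function.Injective f := fun a b hab => e.injective (congrArg (fun p => (ofLex p).2) hab)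
  let L : LinearOrder V := LinearOrder.lift' f hf
  refine ⟨L, fun v => ?_⟩
  have hsub := front_subset_bag t hh (fun u v huv => by
    have huv' : f u ≤ f v := huv
    rcases Prod.Lex.toLex_le_toLex.1 huv' with hlt | ⟨heq, -⟩
    · exact hlt.le
    · exact heq.le) v
  have hsub' : front G v ⊆ t.bag (h v) \ {v} := fun u hu =>
    ⟨hsub hu, fun huv => hu.1 (by rw [mem_singleton_iff.1 huv]; exact self_mem_cone v)⟩
  refine (encard_le_encard hsub').trans ?_
  rw [encard_sdiff_singleton_of_mem (hmem v)]
  exact (le_iSup (fun x => (t.bag x).encard - 1) (h v)).trans ht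

end GuidedDecomp

theorem mainTheorem4 {V : Type*} [Finite V] (G : SimpleGraph V) (k : ℕ)
    (hk : GuidedDecomp.treewidth G ≤ (k : ℕ∞)) :
    ∃ t : GuidedDecomp.TreeDecomposition G,
      (∀ x : t.Node, GuidedDecomp.pathwidth (t.marginalGraph x) ≤ ((2 * k + 1 : ℕ) : ℕ∞)) ∧
      ∃ Λ : GuidedDecomp.GuidanceSystem G,
        Λ.Captures t.adhesions ∧ Λ.Colorable (4 * k ^ 3 + 2 * k) := by
  -- An infimum over no decompositions would be `⊤`, so the bound provides one, and then the infimum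
  -- in `ℕ∞` is attained.
  have hne : Nonempty (GuidedDecomp.TreeDecomposition G) := by
    by_contra hemp
    rw [not_nonempty_iff] at hemp
    rw [GuidedDecomp.treewidth, iInf_of_empty, top_le_iff] at hk
    exact absurd hk (ENat.natCast_ne_top k)
  obtain ⟨t, ht⟩ := ENat.exists_eq_iInf (fun t : GuidedDecomp.TreeDecomposition G => t.width)
  obtain ⟨_, hfront⟩ := GuidedDecomp.exists_linearOrder_front t (ht.le.trans hk)
  exact GuidedDecomp.exists_treeDecomposition_of_front hfront
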